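/- Let $m\ge 1$ be an integer. Let $h_i$ ($i\in\mathbb Z$) be the generators of the Heisenberg algebra, $[h_i,h_j]=i\,\delta_{i+j,0}$, and for $\lambda\in\mathbb C$ let $H_\lambda=\mathbb C[h_{-1},h_{-2},\ldots]|\lambda\rangle$ be the Fock space with highest weight vector $|\lambda\rangle$ ($h_i|\lambda\rangle=0$ for $i>0$, $h_0|\lambda\rangle=\lambda|\lambda\rangle$). On $L=\bigoplus_{c\in\mathbb Z}H_{c/\sqrt{2m}}$ consider the bosonic vertex operator $$\phi_{\sqrt{2m}}(z)=\exp\Big(\sqrt{2m}\sum_{n\ge1}\frac{h_{-n}}{n}z^{n}\Big)\exp\Big(-\sqrt{2m}\sum_{n\ge1}\frac{h_{n}}{n}z^{-n}\Big)T\,z^{\sqrt{2m}\,h_0}=\sum_{n\in\mathbb Z}a_nz^{-n-1},$$ where $T:H_\lambda\to H_{\lambda+\sqrt{2m}}$ commutes with all $h_i$, $i\ne0$, and $T|\lambda\rangle=|\lambda+\sqrt{2m}\rangle$; and let $$L_0=\tfrac12h_0^2+\sum_{n\ge1}h_{-n}h_n-\frac{m-1}{\sqrt{2m}}h_0 .$$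 For $p\in\mathbb Z$ put $v_p=|{-p}/\sqrt{2m}\rangle$, with $\deg_zv_p=\frac{-p}{\sqrt{2m}}$ and $\deg_qv_p=\frac{p^2}{4m}+\frac{p(m-1)}{2m}$, the eigenvalues of $h_0$ and $L_0$ on $v_p$. For $p\in\mathbb Z$, $n\ge0$ let $V_{(m),p}(n)=\mathbb C[a_{p-1},\ldots,a_{p-n}]\cdot v_p$, and for $p\ge0$ let $V_{(m)}(p)=V_{(m),p}(p)=\mathbb C[a_{p-1},\ldots,a_0]\cdot v_p$. Then: (a) For every integer $p\ge0$ the space $V_{(m)}(p)$ is finite-dimensional and is the direct sum of its common eigenspaces for $h_0$ and $L_0$, and its character $\mathrm{ch}(z,q,V)=\mathrm{Tr}(z^{h_0}q^{L_0}|_V)$, the formal sum $\sum_{a,b}\dim\{v\in V:h_0v=av,\ L_0v=bv\}\,z^aq^b$, is $$\mathrm{ch}(z,q,V_{(m)}(p))=z^{\deg_zv_p}\sum_{k\ge0}z^{k\sqrt{2m}}\,q^{\deg_qv_{p-2km}}\binom{p-(m-1)(k-1)}{k}_q ,$$ where $\binom{N}{k}_q$ is the Gaussian binomial coefficient, equal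 to $0$ unless $0\le k\le N$. (b) For all $p\in\mathbb Z$ and $n\ge0$ the space $V_{(m),p}(n)$ is finite-dimensional and $\dim V_{(m),p}(n)=F^{(m)}_n$, where $F^{(m)}_i=i+1$ for $0\le i<m$ and $F^{(m)}_{i+m}=F^{(m)}_{i+m-1}+F^{(m)}_i$ for $i\ge0$. -/

import Mathlib

open Polynomial

noncomputable section

namespace BosonicPrincipal

/-- The number `√(2m)`, as a complex number. -/
def sqrtTwo (m : ℕ) : ℂ := ((Real.sqrt (2 * (m : ℝ)) : ℝ) : ℂ)

/-- A Fock space `H_lam = ℂ[h₋₁, h₋₂, …] |lam⟩`, written as a polynomial ring: the variable `X n`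
(`n ≥ 1`) stands for `h₋ₙ`, and the polynomial `1` for the highest weight vector. -/
abbrev Fock : Type := MvPolynomial ℕ+ ℂ

/-- The space `⨁_{i=0}^{2m-1} L_{(m),i} = ⨁_{c ∈ ℤ} H_{c/√(2m)}`; the component of index `c : ℤ` is
the Fock space with `h₀`-eigenvalue `c/√(2m)`. (`L_{(m),i}` is the sum of the components with
`c ≡ i` modulo `2m`.) -/
abbrev Space : Type := ℤ →₀ Fock

/-- The extremal vector `v_p = |-p/√(2m)⟩`. -/
def extremal (p : ℤ) : Space := Finsupp.single (-p) 1

/-- The Heisenberg operators `h_n`, `n ∈ ℤ`, with `[h_i, h_j] = i δ_{i+j,0}`: on each Fock space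
`h_n = n ∂/∂h₋ₙ` for `n > 0`, `h_n` is multiplication by `h_n` for `n < 0`, and
`h₀` is the scalar `c/√(2m)` on the component of index `c`. -/
def heis (m : ℕ) : ℤ → Module.End ℂ Space
  | .ofNat 0 => Finsupp.lsum ℂ fun c : ℤ => ((c : ℂ) / sqrtTwo m) • Finsupp.lsingle c
  | .ofNat (k + 1) => Finsupp.mapRange.linearMap
      (((k : ℂ) + 1) • ((MvPolynomial.pderiv k.succPNat : Derivation ℂ Fock Fock) : Fock →ₗ[ℂ] Fock))
  | .negSucc k => Finsupp.mapRange.linearMap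
      (LinearMap.mulLeft ℂ (MvPolynomial.X k.succPNat : Fock))

/-- Only finitely many positive Heisenberg modes act nontrivially on a given vector. -/
theorem heis_finite (m : ℕ) (v : Space) :
    (Function.support fun k : ℕ => heis m (-((k : ℤ) + 1)) (heis m ((k : ℤ) + 1) v)).Finite := by
  have key : ∀ k : ℕ, k.succPNat ∉ v.support.biUnion (fun c => (v c).vars) →
      heis m ((k : ℤ) + 1) v = 0 := by
    intro k hk
    have h1 : heis m ((k : ℤ) + 1) = heis m (.ofNat (k + 1)) := rfl
    rw [h1]
    ext1 c
    simp only [heis, Finsupp.mapRange.linearMap_apply, Finsupp.mapRange_apply,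
      LinearMap.smul_apply, Finsupp.coe_zero, Pi.zero_apply]
    have : k.succPNat ∉ (v c).vars := by
      intro h
      apply hk
      rw [Finset.mem_biUnion]
      refine ⟨c, ?_, h⟩
      rw [Finsupp.mem_support_iff]
      intro h0
      simp [h0] at h
    have h2 : MvPolynomial.pderiv k.succPNat (v c) = 0 :=
      MvPolynomial.pderiv_eq_zero_of_notMem_vars this
    simp [h2]
  refine Set.Finite.subset
    (((v.support.biUnion (fun c => (v c).vars)).finite_toSet).preimage
      (f := Nat.succPNat) (Nat.succPNat_injective.injOn)) ?_
  intro k hk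
  by_contra h
  apply hk
  have := key k (by simpa using h)
  simp only [this, map_zero]

/-- The Virasoro operator
`L₀ = ½ ∑_{i+j=0} :h_i h_j: - (m-1)/√(2m) h₀ = ½ h₀² + ∑_{n≥1} h₋ₙ hₙ - (m-1)/√(2m) h₀`. -/
def virL0 (m : ℕ) : Module.End ℂ Space where
  toFun v := (1 / 2 : ℂ) • heis m 0 (heis m 0 v)
    + (∑ᶠ k : ℕ, heis m (-((k : ℤ) + 1)) (heis m ((k : ℤ) + 1) v))
    - (((m : ℂ) - 1) / sqrtTwo m) • heis m 0 v
  map_add' v w := by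
    have := finsum_add_distrib (heis_finite m v) (heis_finite m w)
    simp only [map_add, smul_add, this]
    abel
  map_smul' c v := by
    have := smul_finsum' c (heis_finite m v)
    simp only [map_smul, RingHom.id_apply, smul_sub, smul_add, this, smul_comm _ c]

/-- The creation part `exp(√(2m) ∑_{n≥1} h₋ₙ zⁿ/n)` of the vertex operator, a power series in `z`
whose coefficients are polynomials in the `h₋ₙ`. -/
def creation (m : ℕ) : PowerSeries Fock :=
  (PowerSeries.exp ℂ).subst (PowerSeries.mk fun n : ℕ =>
    if h : 0 < n then MvPolynomial.C (sqrtTwo m / n) * MvPolynomial.X (⟨n, h⟩ : ℕ+) else (0 : Fock))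

/-- The coefficient of `z^r` in the creation part, for `r ∈ ℤ` (zero for negative `r`). -/
def creationCoeff (m : ℕ) (r : ℤ) : Fock :=
  if 0 ≤ r then PowerSeries.coeff r.toNat (creation m) else 0

/-- The annihilation part `exp(-√(2m) ∑_{n≥1} hₙ z⁻ⁿ/n)` of the vertex operator, as a map to
polynomials in `w = z⁻¹`. As `hₙ = n ∂/∂h₋ₙ`, this is `exp(-√(2m) ∑_{n≥1} wⁿ ∂/∂h₋ₙ)`, which by
Taylor's formula is the substitution `h₋ₙ ↦ h₋ₙ - √(2m) wⁿ`. -/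
def annihilation (m : ℕ) : Fock →ₐ[ℂ] Fock[X] :=
  MvPolynomial.aeval fun n : ℕ+ =>
    (C (MvPolynomial.X n) - C (MvPolynomial.C (sqrtTwo m)) * X ^ (n : ℕ) : Fock[X])

/-- The restriction to the component of index `c` of the mode `a_j` of the bosonic vertex operator
`φ(z) = exp(√(2m) ∑_{n≥1} h₋ₙ zⁿ/n) exp(-√(2m) ∑_{n≥1} hₙ z⁻ⁿ/n) e^{√(2m) q} z^{√(2m) h₀}
      = ∑_j a_j z^{-j-1}`.
On that component `z^{√(2m) h₀} = z^c`, so the term `z^r` of the creation part and the term `z^{-s}`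
of the annihilation part contribute to `a_j` exactly when `c + r - s = -j-1`. -/
def modeOn (m : ℕ) (j c : ℤ) : Fock →ₗ[ℂ] Fock :=
  (Polynomial.lsum fun s : ℕ =>
      LinearMap.mulLeft ℂ (creationCoeff m ((s : ℤ) - j - 1 - c))) ∘ₗ (annihilation m).toLinearMap

/-- The mode `a_j` of the vertex operator; the factor `e^{√(2m) q}` raises the eigenvalue of `h₀`
by `√(2m)`, i.e. the index of the component by `2m`. -/
def mode (m : ℕ) (j : ℤ) : Module.End ℂ Space :=
  Finsupp.lsum ℂ fun c : ℤ => Finsupp.lsingle (c + 2 * (m : ℤ)) ∘ₗ modeOn m j c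

/-- The subspace `V_{(m),p}(n) = ℂ[a_{p-1}, …, a_{p-n}] · v_p`. -/
def finitization (m : ℕ) (p : ℤ) (n : ℕ) : Submodule ℂ Space :=
  (Subalgebra.toSubmodule (Algebra.adjoin ℂ (mode m '' Set.Icc (p - n) (p - 1)))).map
    (LinearMap.applyₗ (extremal p))

/-- The subspace `V_{(m)}(p) = ℂ[a_{p-1}, …, a_0] · v_p`. -/
def principal (m p : ℕ) : Submodule ℂ Space := finitization m p p

/-- The part of `V` of bidegree `(a, b)`: the common eigenvectors of `h₀` (eigenvalue `a`) and
`L₀` (eigenvalue `b`) in `V`. -/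
def bidegreePart (m : ℕ) (V : Submodule ℂ Space) (d : ℂ × ℂ) : Submodule ℂ Space :=
  V ⊓ Module.End.eigenspace (heis m 0) d.1 ⊓ Module.End.eigenspace (virL0 m) d.2

/-- Formal finite sums of terms `n z^a q^b` with `n ∈ ℤ` and complex exponents `a`, `b`. -/
abbrev CharRing : Type := AddMonoidAlgebra ℤ (ℂ × ℂ)

/-- `z^a`. -/
def zPow (a : ℂ) : CharRing := AddMonoidAlgebra.single (a, 0) 1

/-- `q^b`. -/
def qPow (b : ℂ) : CharRing := AddMonoidAlgebra.single (0, b) 1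

/-- The character `ch(z,q,V) = Tr(z^{h₀} q^{L₀}|_V) = ∑_{(a,b)} dim(V_{a,b}) z^a q^b` of a
finite-dimensional subspace that is spanned by its bihomogeneous parts. -/
def character (m : ℕ) (V : Submodule ℂ Space) : CharRing :=
  ∑ᶠ d : ℂ × ℂ, (Module.finrank ℂ (bidegreePart m V d) : ℤ) • (zPow d.1 * qPow d.2)

/-- `deg_z v_p`, the eigenvalue of `h₀` on `v_p`. -/
def degZ (m : ℕ) (p : ℤ) : ℂ := -(p : ℂ) / sqrtTwo m

/-- `deg_q v_p`, the eigenvalue of `L₀` on `v_p`. -/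
def degQ (m : ℕ) (p : ℤ) : ℂ := (p : ℂ) ^ 2 / (4 * m) + (p : ℂ) * ((m : ℂ) - 1) / (2 * m)

/-- The Gaussian binomial coefficient for natural arguments, by the `q`-Pascal rule. -/
def gaussNat : ℕ → ℕ → ℤ[X]
  | _, 0 => 1
  | 0, _ + 1 => 0
  | n + 1, k + 1 => gaussNat n k + X ^ (k + 1) * gaussNat n (k + 1)

/-- The `q`-binomial coefficient `[n choose k]` as a polynomial in `q`; it is zero unless
`0 ≤ k ≤ n`. -/
def gauss (n : ℤ) (k : ℕ) : ℤ[X] := if 0 ≤ n then gaussNat n.toNat k else 0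

/-- A polynomial in `q`, seen in the ring of characters. -/
def ofQ (f : ℤ[X]) : CharRing := Polynomial.aeval (qPow 1) f

/-- The numbers `F^{(m)}_i` (for `m ≥ 1`): `F_i = i + 1` for `i < m`, and
`F_i = F_{i-1} + F_{i-m}` for `i ≥ m`. -/
def fibNum (m : ℕ) (i : ℕ) : ℕ :=
  if _h : i < m ∨ m = 0 then i + 1 else fibNum m (i - 1) + fibNum m (i - m)
termination_by i
decreasing_by all_goals omega

theorem fibNum_of_lt {m i : ℕ} (h : i < m) : fibNum m i = i + 1 := by
  rw [fibNum, dif_pos (Or.inl h)]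

theorem fibNum_add {m : ℕ} (hm : 1 ≤ m) (i : ℕ) :
    fibNum m (i + m) = fibNum m (i + m - 1) + fibNum m i := by
  rw [fibNum, dif_neg (by omega), Nat.add_sub_cancel]

theorem sqrtTwo_ne_zero {m : ℕ} (hm : 1 ≤ m) : sqrtTwo m ≠ 0 := by
  have : (0 : ℝ) < m := by exact_mod_cast hm
  exact Complex.ofReal_ne_zero.2 (Real.sqrt_pos.2 (by positivity)).ne'

theorem sqrtTwo_sq (m : ℕ) : sqrtTwo m ^ 2 = 2 * m := by
  have : Real.sqrt (2 * (m : ℝ)) ^ 2 = 2 * m := Real.sq_sqrt (by positivity)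
  rw [sqrtTwo, ← Complex.ofReal_pow, this]
  push_cast
  rfl

theorem heis_zero_extremal (m : ℕ) (p : ℤ) :
    heis m 0 (extremal p) = degZ m p • extremal p := by
  have h1 : heis m 0 = heis m (.ofNat 0) := rfl
  rw [h1]
  simp [heis, extremal, degZ]

theorem virL0_extremal {m : ℕ} (hm : 1 ≤ m) (p : ℤ) :
    virL0 m (extremal p) = degQ m p • extremal p := by
  have hs := sqrtTwo_ne_zero hm
  have hsq := sqrtTwo_sq m
  have hm0 : (m : ℂ) ≠ 0 := by exact_mod_cast (by omega : m ≠ 0)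
  have hz : ∀ k : ℕ, heis m ((k : ℤ) + 1) (extremal p) = 0 := by
    intro k
    have h1 : heis m ((k : ℤ) + 1) = heis m (.ofNat (k + 1)) := rfl
    rw [h1]
    simp [heis, extremal]
  simp only [virL0, LinearMap.coe_mk, AddHom.coe_mk, hz, map_zero, finsum_zero,
    heis_zero_extremal, map_smul, smul_smul, add_zero, ← sub_smul]
  congr 1
  have h2 : degZ m p * degZ m p = (p : ℂ) ^ 2 / (2 * m) := by
    rw [← hsq, degZ]; field_simp
  have h3 : ((m : ℂ) - 1) / sqrtTwo m * degZ m p = -((m : ℂ) - 1) * p / (2 * m) := by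
    rw [← hsq, degZ]; field_simp
  rw [h3, h2, degQ]
  field_simp
  ring

end BosonicPrincipal

end

open BosonicPrincipal

noncomputable section

namespace BosonicPrincipal

/-! ### Formal logarithmic derivatives -/

/-! Write E(z) for the creation series and V for the Vandermonde product in z_1, …, z_k. Normal
ordering, i.e. moving an annihilation factor past E, costs a factor (1 - z_i/z_j)^{2m}. Hence the
product of the k modes a_{p-1-a_i} applied to v_p is the coefficient of z^a in V(z)^{2m}
E(z_1)⋯E(z_k), placed in the component -p + 2mk (`prod_mode_extremal`). The finitized space
therefore splits by k and by the Fock degree d into pieces `fockPart`, spanned by these coefficients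
with all a_i < n and ∑ a_i = mk(k-1) + d. The claim is that such a piece has the dimension of the
space of symmetric polynomials in k variables, homogeneous of degree d, with all exponents below N =
n - m(k-1).

Both bounds rest on the bilinear form for which h_{-r} is adjoint to h_r. Since r ∂/∂h_{-r}
multiplies E(z) by √(2m) z^r, pairing F with ∏ E(z_i) yields F evaluated at h_{-r} = √(2m) p_r(z),
where p_r is the power sum (`fockPair_prod`).

Upper bound: evaluate instead at h_{-r} = (√(2m)/2) p_r(x). This turns E(z) into ∏ (1 - x_i z)^{-m}.
It is injective on the span of products of k coefficients of E, because a kernel element u gives a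
rescaled u orthogonal to the conjugate of u, and that pairing is a sum of positive multiples of
squared absolute values (`eq_zero_of_powerSums_eq_zero`). The image is symmetric and homogeneous,
and its exponents are below N (`powerSums_conv_support`), because V^{2m} times a coefficient of high
degree of ∏ (1 - z_i T)^{-m} lies in the ideal (z_1^n, …, z_k^n) (`vdm_pow_mul_coeff_mem`).

Lower bound: a symmetric τ is the evaluation at √(2m) p_r of some Fock vector, and pairing with that
vector sends the generator of exponent a to the coefficient of z^a in V^{2m} τ. If these all vanish
for a_i < n, then moving one factor V^m across the form (constant term of A(z)B(1/z)) shows that V^m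
τ has norm zero, so τ = 0 (`eq_zero_of_coeff_vdm_mul`).

Counting partitions in a box by the q-Pascal rule gives the Gaussian binomials. Different (k, d)
have different eigenvalues of the commuting operators h₀ and L₀, so the pieces are independent,
which gives the character. At q = 1 the Pascal rule, summed over k, becomes the recursion of
F^{(m)}. -/

/-- `Y' = A Y`. -/
def HasLogDeriv {R : Type*} [CommRing R] (Y A : PowerSeries R) : Prop :=
  PowerSeries.derivative R Y = A * Y

namespace HasLogDeriv

variable {R : Type*} [CommRing R] {Y Z A B : PowerSeries R}

theorem mul (hY : HasLogDeriv Y A) (hZ : HasLogDeriv Z B) : HasLogDeriv (Y * Z) (A + B) := by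
  unfold HasLogDeriv at *
  rw [Derivation.leibniz, hY, hZ, smul_eq_mul, smul_eq_mul]
  ring

theorem one : HasLogDeriv (1 : PowerSeries R) 0 := by
  unfold HasLogDeriv
  simp

theorem prod {ι : Type*} (s : Finset ι) (Y A : ι → PowerSeries R)
    (h : ∀ i ∈ s, HasLogDeriv (Y i) (A i)) : HasLogDeriv (∏ i ∈ s, Y i) (∑ i ∈ s, A i) := by
  classical
  induction s using Finset.induction_on with
  | empty => simpa using one
  | insert a s ha ih =>
    rw [Finset.prod_insert ha, Finset.sum_insert ha]
    exact (h a (by simp)).mul (ih fun i hi => h i (by simp [hi]))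

theorem pow (hY : HasLogDeriv Y A) (n : ℕ) : HasLogDeriv (Y ^ n) (n * A) := by
  have := prod (Finset.range n) (fun _ => Y) (fun _ => A) (fun _ _ => hY)
  simpa using this

theorem neg_of_mul_eq_one (hY : HasLogDeriv Y A) (h : Y * Z = 1) : HasLogDeriv Z (-A) := by
  unfold HasLogDeriv at *
  have h1 : PowerSeries.derivative R (Y * Z) = 0 := by rw [h, PowerSeries.derivative_one]
  rw [Derivation.leibniz, hY, smul_eq_mul, smul_eq_mul] at h1
  have h2 : Z * Y * PowerSeries.derivative R Z + Z * A * (Y * Z) = 0 := by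
    linear_combination Z * h1
  rw [mul_comm Z Y, h] at h2
  linear_combination h2

theorem map {S : Type*} [CommRing S] (f : R →+* S) (hY : HasLogDeriv Y A) :
    HasLogDeriv (PowerSeries.map f Y) (PowerSeries.map f A) := by
  unfold HasLogDeriv at *
  rw [← map_mul, ← hY]
  ext n
  simp [PowerSeries.coeff_derivative]

theorem coeff_succ (hY : HasLogDeriv Y A) (n : ℕ) :
    PowerSeries.coeff (n + 1) Y * (n + 1) =
      ∑ i ∈ Finset.range (n + 1), PowerSeries.coeff i A * PowerSeries.coeff (n - i) Y := by
  rw [← PowerSeries.coeff_derivative, hY, PowerSeries.coeff_mul,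
    Finset.Nat.sum_antidiagonal_eq_sum_range_succ
      (f := fun i j => PowerSeries.coeff i A * PowerSeries.coeff j Y)]

/-- The equation Y' = A Y computes (n+1) Y_{n+1} from the earlier coefficients, and n+1 can be
cancelled. Identities between exponentials thus reduce to comparing logarithmic derivatives and
constant terms. -/
theorem unique [IsDomain R] [CharZero R] (hY : HasLogDeriv Y A) (hZ : HasLogDeriv Z A)
    (h : PowerSeries.coeff 0 Y = PowerSeries.coeff 0 Z) : Y = Z := by
  ext n
  induction n using Nat.strong_induction_on with
  | _ n ih =>
    rcases n with _ | n
    · exact h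
    · have hn : (n + 1 : R) ≠ 0 := by exact_mod_cast Nat.succ_ne_zero n
      apply mul_right_cancel₀ hn
      rw [hY.coeff_succ, hZ.coeff_succ]
      exact Finset.sum_congr rfl fun i hi => by rw [ih (n - i) (by omega)]

end HasLogDeriv

/-- The geometric series `∑ x^{i+1} z^i = x / (1 - x z)`. -/
def geomSeries {R : Type*} [CommRing R] (x : R) : PowerSeries R := PowerSeries.mk fun i => x ^ (i + 1)

/-- The power series `1 - x z`. -/
def oneSub {R : Type*} [CommRing R] (x : R) : PowerSeries R := 1 - PowerSeries.C x * PowerSeries.X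

theorem oneSub_mul_geomSeries {R : Type*} [CommRing R] (x : R) :
    oneSub x * geomSeries x = PowerSeries.C x := by
  ext n
  rw [oneSub, sub_mul, one_mul, mul_assoc, map_sub, PowerSeries.coeff_C_mul]
  rcases n with _ | n
  · simp [geomSeries]
  · rw [PowerSeries.coeff_succ_X_mul]
    simp [geomSeries]
    ring

theorem hasLogDeriv_oneSub {R : Type*} [CommRing R] (x : R) :
    HasLogDeriv (oneSub x) (-geomSeries x) := by
  unfold HasLogDeriv
  rw [neg_mul, mul_comm, oneSub_mul_geomSeries, oneSub, map_sub, PowerSeries.derivative_one,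
    Derivation.leibniz]
  simp

theorem coeff_oneSub_pow {R : Type*} [CommRing R] (x : R) (N n : ℕ) :
    PowerSeries.coeff n (oneSub x ^ N) = (-1) ^ n * (N.choose n : R) * x ^ n := by
  have h : oneSub x = PowerSeries.rescale (-x) ((1 + Polynomial.X : R[X]) : PowerSeries R) := by
    ext n
    rcases n with _ | _ | n <;> simp [oneSub, PowerSeries.coeff_one]
  rw [h, ← map_pow, PowerSeries.coeff_rescale, ← Polynomial.coe_pow, Polynomial.coeff_coe,
    Polynomial.coeff_one_add_X_pow, neg_pow]
  ring

/-- The inverse `(1 - x z)^{-N}`. -/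
def oneSubInvPow {R : Type*} [CommRing R] (x : R) (N : ℕ) : PowerSeries R :=
  PowerSeries.rescale x (PowerSeries.invOneSubPow R N : PowerSeries R)

theorem oneSub_pow_mul_inv {R : Type*} [CommRing R] (x : R) (N : ℕ) :
    oneSub x ^ N * oneSubInvPow x N = 1 := by
  have h : oneSub x = PowerSeries.rescale x (1 - PowerSeries.X) := by
    rw [map_sub, map_one, PowerSeries.rescale_X, oneSub]
  rw [h, oneSubInvPow, ← map_pow, ← map_mul, ← PowerSeries.invOneSubPow_inv_eq_one_sub_pow]
  simp

theorem coeff_oneSubInvPow {R : Type*} [CommRing R] (x : R) (N n : ℕ) :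
    PowerSeries.coeff n (oneSubInvPow x (N + 1)) = ((N + n).choose N : R) * x ^ n := by
  rw [oneSubInvPow, PowerSeries.coeff_rescale, PowerSeries.invOneSubPow_val_succ_eq_mk_add_choose]
  simp [mul_comm]

theorem coeff_zero_oneSubInvPow {R : Type*} [CommRing R] (x : R) (N : ℕ) :
    PowerSeries.coeff 0 (oneSubInvPow x N) = 1 := by
  rw [oneSubInvPow, PowerSeries.coeff_rescale]
  rcases N with _ | N
  · simp [PowerSeries.invOneSubPow_zero]
  · rw [PowerSeries.invOneSubPow_val_succ_eq_mk_add_choose]; simp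

/-! ### The creation series -/

theorem creation_hasLogDeriv (m : ℕ) :
    HasLogDeriv (creation m) (PowerSeries.mk fun i =>
      MvPolynomial.C (sqrtTwo m) * (MvPolynomial.X i.succPNat : Fock)) := by
  set g : PowerSeries Fock := PowerSeries.mk fun n : ℕ =>
    if h : 0 < n then MvPolynomial.C (sqrtTwo m / n) * MvPolynomial.X (⟨n, h⟩ : ℕ+) else (0 : Fock)
    with hg
  have hs : PowerSeries.HasSubst g := PowerSeries.HasSubst.of_constantCoeff_zero' (by
    rw [← PowerSeries.coeff_zero_eq_constantCoeff_apply]; simp [hg])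
  -- The exponential is first given coefficients in `Fock`, so that the chain rule for substitution
  -- takes place over one ring.
  have h1 : creation m = (PowerSeries.exp Fock).subst g := by
    rw [creation, ← hg]
    ext n : 1
    rw [PowerSeries.coeff_subst' hs, PowerSeries.coeff_subst' hs]
    refine finsum_congr fun d => ?_
    rw [PowerSeries.coeff_exp, PowerSeries.coeff_exp, ← algebraMap_smul Fock,
      ← IsScalarTower.algebraMap_apply]
  unfold HasLogDeriv
  rw [h1, PowerSeries.derivative_subst hs, PowerSeries.derivative_exp, mul_comm]
  congr 1
  ext n : 1
  rw [PowerSeries.coeff_derivative, hg, PowerSeries.coeff_mk, PowerSeries.coeff_mk,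
    dif_pos (Nat.succ_pos n)]
  have : (n + 1 : Fock) = MvPolynomial.C (n + 1 : ℂ) := by simp
  have key : ∀ x : Fock, MvPolynomial.C (sqrtTwo m / (n + 1 : ℕ)) * x * (n + 1 : Fock) =
      MvPolynomial.C (sqrtTwo m) * x := by
    intro x
    have hn : (n + 1 : ℂ) ≠ 0 := by exact_mod_cast Nat.succ_ne_zero n
    rw [this, mul_right_comm, ← map_mul]
    congr 2
    push_cast
    field_simp
  exact key _

theorem coeff_zero_creation (m : ℕ) : PowerSeries.coeff 0 (creation m) = 1 := by
  rw [creation, PowerSeries.coeff_subst' (PowerSeries.HasSubst.of_constantCoeff_zero' (by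
    rw [← PowerSeries.coeff_zero_eq_constantCoeff_apply]; simp))]
  rw [finsum_eq_single _ 0]
  · simp
  · intro n hn
    simp [hn]

/-- The coefficients of a power series, indexed by `ℤ` and extended by zero. -/
def intCoeff {R : Type*} [CommRing R] (Y : PowerSeries R) (j : ℤ) : R :=
  if 0 ≤ j then PowerSeries.coeff j.toNat Y else 0

section intCoeff

variable {R S : Type*} [CommRing R] [CommRing S]

theorem intCoeff_of_neg (Y : PowerSeries R) {j : ℤ} (h : j < 0) : intCoeff Y j = 0 :=
  if_neg (by omega)

theorem intCoeff_natCast (Y : PowerSeries R) (n : ℕ) :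
    intCoeff Y (n : ℤ) = PowerSeries.coeff n Y := by
  simp [intCoeff]

theorem map_intCoeff (f : R →+* S) (Y : PowerSeries R) (j : ℤ) :
    f (intCoeff Y j) = intCoeff (PowerSeries.map f Y) j := by
  unfold intCoeff
  split_ifs <;> simp

theorem intCoeff_mul (P Y : PowerSeries R) (j : ℤ) (L : ℕ) (hL : j < L) :
    intCoeff (P * Y) j =
      ∑ l ∈ Finset.range L, PowerSeries.coeff l P * intCoeff Y (j - l) := by
  rcases lt_or_ge j 0 with hj | hj
  · rw [intCoeff_of_neg _ hj, Finset.sum_eq_zero]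
    intro l _
    rw [intCoeff_of_neg _ (by omega), mul_zero]
  · obtain ⟨n, rfl⟩ := Int.eq_ofNat_of_zero_le hj
    rw [intCoeff_natCast, PowerSeries.coeff_mul,
      Finset.Nat.sum_antidiagonal_eq_sum_range_succ
        (f := fun i j => PowerSeries.coeff i P * PowerSeries.coeff j Y)]
    have hsub : Finset.range (n + 1) ⊆ Finset.range L := by
      intro x; simp only [Finset.mem_range]; omega
    rw [← Finset.sum_subset hsub]
    · refine Finset.sum_congr rfl fun l hl => ?_
      rw [Finset.mem_range] at hl
      rw [← intCoeff_natCast Y, Nat.cast_sub (by omega)]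
    · intro l _ hl
      rw [Finset.mem_range] at hl
      rw [intCoeff_of_neg _ (by omega), mul_zero]

end intCoeff

theorem creationCoeff_eq_intCoeff (m : ℕ) (j : ℤ) :
    creationCoeff m j = intCoeff (creation m) j := rfl

theorem creationCoeff_of_neg (m : ℕ) {j : ℤ} (h : j < 0) : creationCoeff m j = 0 :=
  intCoeff_of_neg _ h

theorem creationCoeff_zero (m : ℕ) : creationCoeff m 0 = 1 :=
  (intCoeff_natCast (creation m) 0).trans (coeff_zero_creation m)

theorem creationCoeff_succ (m n : ℕ) :
    creationCoeff m (n + 1 : ℕ) * (n + 1) = ∑ i ∈ Finset.range (n + 1),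
      MvPolynomial.C (sqrtTwo m) * (MvPolynomial.X i.succPNat : Fock) *
        creationCoeff m (n - i : ℕ) := by
  simp only [creationCoeff_eq_intCoeff, intCoeff_natCast]
  rw [(creation_hasLogDeriv m).coeff_succ]
  simp only [PowerSeries.coeff_mk]

theorem map_creation_hasLogDeriv {R : Type*} [CommRing R] (f : Fock →+* R) (m : ℕ) :
    HasLogDeriv (PowerSeries.map f (creation m)) (PowerSeries.mk fun i =>
      f (MvPolynomial.C (sqrtTwo m)) * f (MvPolynomial.X i.succPNat)) := by
  have h := (creation_hasLogDeriv m).map f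
  convert h using 1
  ext i
  simp

/-- The tool for every evaluation of the creation series below: the image under f is identified by
its logarithmic derivative alone. -/
theorem map_creation_eq {R : Type*} [CommRing R] [IsDomain R] [CharZero R] (f : Fock →+* R) (m : ℕ)
    (Z A : PowerSeries R) (hZ : HasLogDeriv Z A) (h0 : PowerSeries.coeff 0 Z = 1)
    (hA : ∀ i : ℕ, PowerSeries.coeff i A =
      f (MvPolynomial.C (sqrtTwo m)) * f (MvPolynomial.X i.succPNat)) :
    PowerSeries.map f (creation m) = Z := by
  refine (map_creation_hasLogDeriv f m).unique ?_ ?_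
  · convert hZ using 1
    ext i
    simp [hA]
  · rw [h0, PowerSeries.coeff_map, coeff_zero_creation, map_one]

theorem constantCoeff_creationCoeff (m : ℕ) (j : ℤ) :
    MvPolynomial.constantCoeff (creationCoeff m j) = if j = 0 then 1 else 0 := by
  rw [creationCoeff_eq_intCoeff, map_intCoeff,
    map_creation_eq MvPolynomial.constantCoeff m 1 0 HasLogDeriv.one (by simp) (by simp)]
  unfold intCoeff
  rcases lt_trichotomy j 0 with h | h | h
  · rw [if_neg (by omega), if_neg (by omega)]
  · subst h; simp
  · rw [if_pos h.le, if_neg h.ne', PowerSeries.coeff_one, if_neg (by omega)]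

theorem conj_sqrtTwo (m : ℕ) : (starRingEnd ℂ) (sqrtTwo m) = sqrtTwo m := by
  simp [sqrtTwo]

theorem map_conj_creationCoeff (m : ℕ) (j : ℤ) :
    MvPolynomial.map (starRingEnd ℂ) (creationCoeff m j) = creationCoeff m j := by
  rw [creationCoeff_eq_intCoeff, map_intCoeff,
    map_creation_eq _ m _ _ (creation_hasLogDeriv m) (coeff_zero_creation m)]
  intro i
  simp [conj_sqrtTwo]

/-- In generating form, r ∂/∂h_{-r} E(z) = √(2m) z^r E(z). The proof is an induction along the
recursion that E' = A E gives for the coefficients. -/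
theorem pderiv_creationCoeff (m : ℕ) (r : ℕ+) (j : ℤ) :
    MvPolynomial.C (r : ℂ) * MvPolynomial.pderiv r (creationCoeff m j) =
      MvPolynomial.C (sqrtTwo m) * creationCoeff m (j - r) := by
  rcases lt_or_ge j 0 with hj | hj
  · rw [creationCoeff_of_neg _ hj, creationCoeff_of_neg _ (by have := r.pos; omega)]
    simp
  obtain ⟨n, rfl⟩ := Int.eq_ofNat_of_zero_le hj
  induction n using Nat.strong_induction_on with
  | _ n ih =>
  rcases n with _ | n
  · rw [Nat.cast_zero, creationCoeff_zero, creationCoeff_of_neg _ (by have := r.pos; omega)]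
    simp
  have hn : (n + 1 : Fock) ≠ 0 := by exact_mod_cast Nat.succ_ne_zero n
  apply mul_right_cancel₀ hn
  have hder : MvPolynomial.pderiv r (creationCoeff m (n + 1 : ℕ)) * (n + 1 : Fock) =
      MvPolynomial.pderiv r (creationCoeff m (n + 1 : ℕ) * (n + 1 : Fock)) := by
    have : (n + 1 : Fock) = MvPolynomial.C (n + 1 : ℂ) := by simp
    rw [this, MvPolynomial.pderiv_mul, MvPolynomial.pderiv_C]
    ring
  rw [mul_assoc, hder, creationCoeff_succ, map_sum, Finset.mul_sum]
  have hterm : ∀ i ∈ Finset.range (n + 1), MvPolynomial.C (r : ℂ) * MvPolynomial.pderiv r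
      (MvPolynomial.C (sqrtTwo m) * (MvPolynomial.X i.succPNat : Fock) *
        creationCoeff m (n - i : ℕ) : Fock) =
      MvPolynomial.C (sqrtTwo m) * ((if i.succPNat = r then
        MvPolynomial.C (r : ℂ) * creationCoeff m ((n + 1 : ℕ) - r) else 0) +
       MvPolynomial.C (sqrtTwo m) * (MvPolynomial.X i.succPNat : Fock) *
        creationCoeff m ((n - i : ℕ) - r)) := by
    intro i hi
    rw [Finset.mem_range] at hi
    rw [MvPolynomial.pderiv_mul, MvPolynomial.pderiv_mul, MvPolynomial.pderiv_C]
    have h1 := ih (n - i) (by omega) (by omega)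
    have h2 : (if i.succPNat = r then
        MvPolynomial.C (r : ℂ) * creationCoeff m ((n + 1 : ℕ) - r) else 0) =
        MvPolynomial.C (r : ℂ) * (if i.succPNat = r then (1 : Fock) else 0) *
          creationCoeff m (n - i : ℕ) := by
      split_ifs with h
      · subst h
        rw [mul_one]
        congr 2
        rw [Nat.succPNat_coe]
        push_cast [Nat.cast_sub (show i ≤ n by omega)]
        ring
      · simp
    have h3 : MvPolynomial.pderiv r (MvPolynomial.X i.succPNat : Fock) =
        if i.succPNat = r then (1 : Fock) else 0 := by
      rw [MvPolynomial.pderiv_X, Pi.single_apply]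
    rw [h2, h3]
    linear_combination MvPolynomial.C (sqrtTwo m) * (MvPolynomial.X i.succPNat : Fock) * h1
  rw [Finset.sum_congr rfl hterm, ← Finset.mul_sum, Finset.sum_add_distrib, mul_assoc]
  congr 1
  -- Differentiating the explicit variable h_{-r} contributes r times the coefficient of index
  -- n+1-r. The remaining sum is the recursion at that index and contributes n+1-r times it, n+1 in
  -- total. The cases n+1 < r and n+1 = r are degenerate.
  rcases lt_or_ge n ((r : ℕ) - 1) with hr | hr
  · rw [creationCoeff_of_neg m (j := (n + 1 : ℕ) - r) (by omega), zero_mul,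
      Finset.sum_eq_zero, Finset.sum_eq_zero, zero_add]
    · intro i hi
      rw [Finset.mem_range] at hi
      rw [creationCoeff_of_neg _ (by omega), mul_zero]
    · simp
  · obtain ⟨s, hs⟩ : ∃ s, r = Nat.succPNat s := ⟨r.natPred, (PNat.succPNat_natPred r).symm⟩
    subst hs
    simp only [Nat.succPNat_coe, Nat.succ_sub_succ_eq_sub, tsub_zero, Nat.succPNat_inj] at hr ⊢
    rw [Finset.sum_ite_eq' , if_pos (Finset.mem_range.2 (by omega))]
    rcases Nat.eq_or_lt_of_le hr with h | h
    · subst h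
      rw [Finset.sum_eq_zero]
      · have : (s + 1 : Fock) = MvPolynomial.C (s + 1 : ℂ) := by simp
        rw [this]
        push_cast
        ring
      · intro i hi
        rw [creationCoeff_of_neg _ (by omega), mul_zero]
    · obtain ⟨t, rfl⟩ : ∃ t, n = s + 1 + t := ⟨n - s - 1, by omega⟩
      have h3 := creationCoeff_succ m t
      have h4 : ∑ i ∈ Finset.range (s + 1 + t + 1),
          MvPolynomial.C (sqrtTwo m) * (MvPolynomial.X i.succPNat : Fock) *
            creationCoeff m ((s + 1 + t - i : ℕ) - (s + 1 : ℕ)) =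
          creationCoeff m (t + 1 : ℕ) * (t + 1) := by
        rw [h3]
        symm
        have hsub : Finset.range (t + 1) ⊆ Finset.range (s + 1 + t + 1) := by
          intro x; simp only [Finset.mem_range]; omega
        rw [← Finset.sum_subset hsub]
        · refine Finset.sum_congr rfl fun i hi => ?_
          rw [Finset.mem_range] at hi
          congr 2
          omega
        · intro i _ hi
          rw [Finset.mem_range] at hi
          rw [creationCoeff_of_neg _ (by omega), mul_zero]
      simp only [Nat.succ_eq_add_one]
      rw [h4]
      have h5 : (((s + 1 + t + 1 : ℕ) : ℤ) - ((s + 1 : ℕ) : ℤ)) = (t + 1 : ℕ) := by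
        push_cast; ring
      rw [h5]
      have h6 : MvPolynomial.C ((s + 1 : ℕ) : ℂ) = ((s + 1 : ℕ) : Fock) := by simp
      rw [h6]
      push_cast
      ring

/-- Normal ordering of two vertex operators: the substitution h_{-i} ↦ h_{-i} - √(2m) w^i multiplies
E(z) by (1 - wz)^{2m}, the exponent being √(2m)². Any L > j may cut off the expansion, so that one L
can serve several indices. -/
theorem annihilation_creationCoeff (m : ℕ) (j : ℤ) (L : ℕ) (hL : j < L) :
    annihilation m (creationCoeff m j) = ∑ l ∈ Finset.range L,
      C ((-1) ^ l * ((2 * m).choose l : Fock) * creationCoeff m (j - l)) * X ^ l := by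
  have h : PowerSeries.map (annihilation m : Fock →+* Fock[X]) (creation m) =
      oneSub (X : Fock[X]) ^ (2 * m) * PowerSeries.map C (creation m) := by
    refine map_creation_eq _ m _ _ (((hasLogDeriv_oneSub _).pow _).mul
      (map_creation_hasLogDeriv C m)) ?_ ?_
    · rw [PowerSeries.coeff_zero_eq_constantCoeff_apply, map_mul,
        ← PowerSeries.coeff_zero_eq_constantCoeff_apply,
        ← PowerSeries.coeff_zero_eq_constantCoeff_apply, coeff_oneSub_pow, PowerSeries.coeff_map,
        coeff_zero_creation]
      simp
    · intro i
      have hc : (C (MvPolynomial.C (sqrtTwo m)) * C (MvPolynomial.C (sqrtTwo m)) : Fock[X]) =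
          ((2 * m : ℕ) : Fock[X]) := by
        rw [← C_mul, ← MvPolynomial.C_mul, ← pow_two, sqrtTwo_sq]
        have h2 : (2 * m : ℂ) = ((2 * m : ℕ) : ℂ) := by push_cast; ring
        rw [h2, map_natCast, map_natCast]
      have h1 : annihilation m (MvPolynomial.C (sqrtTwo m)) = C (MvPolynomial.C (sqrtTwo m)) :=
        MvPolynomial.aeval_C _ _
      have h2 : annihilation m (MvPolynomial.X i.succPNat) = C (MvPolynomial.X i.succPNat) -
          C (MvPolynomial.C (sqrtTwo m)) * X ^ (i + 1) :=
        MvPolynomial.aeval_X _ _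
      rw [map_add, PowerSeries.coeff_mk, ← nsmul_eq_mul, map_nsmul, map_neg, geomSeries,
        PowerSeries.coeff_mk, nsmul_eq_mul]
      change _ = annihilation m (MvPolynomial.C (sqrtTwo m)) *
        annihilation m (MvPolynomial.X i.succPNat)
      rw [h1, h2, ← hc]
      ring
  rw [creationCoeff_eq_intCoeff]
  have h1 := map_intCoeff (annihilation m : Fock →+* Fock[X]) (creation m) j
  rw [h] at h1
  refine h1.trans ?_
  rw [intCoeff_mul _ _ _ L hL]
  refine Finset.sum_congr rfl fun l _ => ?_
  rw [coeff_oneSub_pow, ← map_intCoeff, creationCoeff_eq_intCoeff]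
  simp

/-! ### Coefficient extraction from Q(z) ∏ e(z_i) -/

section conv

variable {R S : Type*} [CommRing R] [CommRing S] [Algebra ℂ R] [Algebra ℂ S] {k : ℕ}

/-- For a sequence `e` and exponents `a`, the coefficient of `z^a` in `Q(z) ∏ᵢ ∑ⱼ e(j) zᵢʲ`, as a
function of the polynomial `Q`. -/
def conv (e : ℤ → R) (a : Fin k → ℤ) : MvPolynomial (Fin k) ℂ →ₗ[ℂ] R :=
  (MvPolynomial.basisMonomials (Fin k) ℂ).constr ℂ fun c => ∏ i, e (a i - c i)

theorem conv_monomial (e : ℤ → R) (a : Fin k → ℤ) (c : Fin k →₀ ℕ) (x : ℂ) :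
    conv e a (MvPolynomial.monomial c x) = x • ∏ i, e (a i - c i) := by
  have h : MvPolynomial.monomial c x = x • MvPolynomial.basisMonomials (Fin k) ℂ c := by
    simp [MvPolynomial.smul_monomial]
  rw [h, map_smul, conv, Module.Basis.constr_basis]

theorem conv_monomial_mul (e : ℤ → R) (a : Fin k → ℤ) (c : Fin k →₀ ℕ) (x : ℂ)
    (Q : MvPolynomial (Fin k) ℂ) :
    conv e a (MvPolynomial.monomial c x * Q) = x • conv e (fun i => a i - c i) Q := by
  induction Q using MvPolynomial.induction_on' with
  | monomial d y =>
    rw [MvPolynomial.monomial_mul, conv_monomial, conv_monomial, smul_smul]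
    congr 1
    refine Finset.prod_congr rfl fun i _ => ?_
    congr 1
    rw [Finsupp.add_apply]
    push_cast
    ring
  | add p q hp hq => rw [mul_add, map_add, map_add, hp, hq, smul_add]

theorem map_conv (f : R →ₐ[ℂ] S) (e : ℤ → R) (a : Fin k → ℤ) (Q : MvPolynomial (Fin k) ℂ) :
    f (conv e a Q) = conv (fun j => f (e j)) a Q := by
  induction Q using MvPolynomial.induction_on' with
  | monomial d y => rw [conv_monomial, conv_monomial, map_smul, map_prod]
  | add p q hp hq => rw [map_add, map_add, map_add, hp, hq]

/-- This is the factorization e(z) = γ(z) e'(z), inserted in each of the k variables and expanded.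
It is needed only for indices below L, as the monomials of Q can only lower the exponents a_i. -/
theorem conv_expand (e e' : ℤ → R) (γ : ℕ → R) (L : ℕ)
    (he : ∀ j : ℤ, j < L → e j = ∑ l ∈ Finset.range L, γ l * e' (j - l))
    (a : Fin k → ℤ) (ha : ∀ i, a i < L) (Q : MvPolynomial (Fin k) ℂ) :
    conv e a Q = ∑ l ∈ Fintype.piFinset fun _ : Fin k => Finset.range L,
      (∏ i, γ (l i)) * conv e' (fun i => a i - l i) Q := by
  induction Q using MvPolynomial.induction_on' with
  | monomial d y =>
    simp only [conv_monomial]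
    have h : ∀ i, e (a i - d i) = ∑ l ∈ Finset.range L, γ l * e' (a i - l - d i) := by
      intro i
      rw [he _ (by have := ha i; omega)]
      refine Finset.sum_congr rfl fun l _ => ?_
      rw [sub_right_comm]
    simp only [h, Finset.prod_univ_sum, Finset.smul_sum, Finset.prod_mul_distrib, mul_smul_comm]
  | add p q hp hq =>
    rw [map_add, hp, hq, ← Finset.sum_add_distrib]
    refine Finset.sum_congr rfl fun l _ => ?_
    rw [map_add, mul_add]

theorem conv_cons (e : ℤ → R) (a₀ : ℤ) (a : Fin k → ℤ) (s : ℕ) (Q : MvPolynomial (Fin k) ℂ) :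
    conv e (Fin.cons a₀ a) (MvPolynomial.X 0 ^ s * MvPolynomial.rename Fin.succ Q) =
      e (a₀ - s) * conv e a Q := by
  induction Q using MvPolynomial.induction_on' with
  | monomial d y =>
    rw [MvPolynomial.rename_monomial, MvPolynomial.X_pow_eq_monomial, MvPolynomial.monomial_mul,
      conv_monomial, conv_monomial, Fin.prod_univ_succ, one_mul, mul_smul_comm]
    have h0 : Finsupp.mapDomain Fin.succ d 0 = 0 :=
      Finsupp.mapDomain_of_notMem_range _ _ (by simp)
    simp [h0, Finsupp.mapDomain_apply (Fin.succ_injective k), Fin.succ_ne_zero]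
  | add p q hp hq => rw [map_add, mul_add, map_add, map_add, hp, hq, mul_add]

end conv

/-! ### Products of modes and the Vandermonde factor -/

/-- The Vandermonde product `∏_{i<j} (X_j - X_i)`. -/
def vdm (k : ℕ) : MvPolynomial (Fin k) ℂ :=
  ∏ i : Fin k, ∏ j ∈ Finset.Ioi i, (MvPolynomial.X j - MvPolynomial.X i)

theorem vdm_succ (k : ℕ) : vdm (k + 1) =
    (∏ j : Fin k, (MvPolynomial.X j.succ - MvPolynomial.X 0)) *
      MvPolynomial.rename Fin.succ (vdm k) := by
  rw [vdm, Fin.prod_univ_succ, Fin.prod_Ioi_zero]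
  simp only [Fin.prod_Ioi_succ, vdm, map_prod, map_sub, MvPolynomial.rename_X]

theorem modeOn_C_mul_X_pow (m : ℕ) (j c : ℤ) (f : Fock) (ι : Type) (s : Finset ι)
    (t : ι → ℕ) (g : ι → Fock) (h : annihilation m f = ∑ i ∈ s, C (g i) * X ^ t i) :
    modeOn m j c f = ∑ i ∈ s, creationCoeff m ((t i : ℤ) - j - 1 - c) * g i := by
  rw [modeOn, LinearMap.comp_apply, AlgHom.toLinearMap_apply, h, map_sum]
  refine Finset.sum_congr rfl fun i _ => ?_
  rw [Polynomial.C_mul_X_pow_eq_monomial, Polynomial.lsum_apply, Polynomial.sum_monomial_index]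
  · rfl
  · simp

theorem mode_single (m : ℕ) (j c : ℤ) (f : Fock) :
    mode m j (Finsupp.single c f) = Finsupp.single (c + 2 * (m : ℤ)) (modeOn m j c f) := by
  simp [mode]

/-- The annihilation part with w = 1/z_0 produces ∏ (1 - z_i/z_0)^{2m} = z_0^{-2mk} ∏ (z_i -
z_0)^{2m}. The shift by 2mk in the hypothesis on a₀ clears this denominator. -/
theorem modeOn_conv (m k : ℕ) (j c a₀ : ℤ) (h : -j - 1 - c = a₀ - 2 * m * k) (a : Fin k → ℤ)
    (Q : MvPolynomial (Fin k) ℂ) :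
    modeOn m j c (conv (creationCoeff m) a Q) = conv (creationCoeff m) (Fin.cons a₀ a)
      ((∏ i : Fin k, (MvPolynomial.X i.succ - MvPolynomial.X 0)) ^ (2 * m) *
        MvPolynomial.rename Fin.succ Q) := by
  obtain ⟨L, hL2, hLa⟩ : ∃ L : ℕ, 2 * m < L ∧ ∀ i, a i < L := by
    refine ⟨2 * m + 1 + ∑ i, (a i).toNat, by omega, fun i => ?_⟩
    have := Finset.single_le_sum (f := fun i => (a i).toNat) (fun _ _ => Nat.zero_le _)
      (Finset.mem_univ i)
    have := Int.self_le_toNat (a i)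
    omega
  have h1 : annihilation m (conv (creationCoeff m) a Q) =
      ∑ l ∈ Fintype.piFinset fun _ : Fin k => Finset.range L,
        C (MvPolynomial.C (∏ i, ((-1) ^ l i * ((2 * m).choose (l i) : ℂ))) *
          conv (creationCoeff m) (fun i => a i - l i) Q) * X ^ (∑ i, l i) := by
    rw [map_conv, conv_expand _ (fun j => C (creationCoeff m j))
      (fun l => C (MvPolynomial.C ((-1) ^ l * ((2 * m).choose l : ℂ))) * X ^ l) L ?_ a hLa]
    · refine Finset.sum_congr rfl fun l _ => ?_
      have h3 := map_conv (Polynomial.CAlgHom : Fock →ₐ[ℂ] Fock[X]) (creationCoeff m)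
        (fun i => a i - l i) Q
      simp only [Polynomial.CAlgHom_apply] at h3
      rw [← h3, Finset.prod_mul_distrib, Finset.prod_pow_eq_pow_sum, map_prod, C_mul,
        map_prod]
      ring
    · intro j hj
      rw [annihilation_creationCoeff m j L hj]
      refine Finset.sum_congr rfl fun l _ => ?_
      simp only [C_mul, MvPolynomial.C_mul, map_pow, map_neg, map_one, map_natCast]
      ring
  rw [modeOn_C_mul_X_pow m j c _ _ _ _ _ h1]
  have h2 : (∏ i : Fin k, (MvPolynomial.X i.succ - MvPolynomial.X 0)) ^ (2 * m) *
        MvPolynomial.rename Fin.succ Q =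
      ∑ l ∈ Fintype.piFinset fun _ : Fin k => Finset.range L,
        MvPolynomial.X 0 ^ (2 * m * k - ∑ i, l i) * MvPolynomial.rename Fin.succ
          (MvPolynomial.monomial (Finsupp.equivFunOnFinite.symm l)
            (∏ i, ((-1) ^ l i * ((2 * m).choose (l i) : ℂ))) * Q) := by
    have h3 : ∀ i : Fin k, (MvPolynomial.X i.succ - MvPolynomial.X 0 :
        MvPolynomial (Fin (k + 1)) ℂ) ^ (2 * m) = ∑ l ∈ Finset.range L,
        MvPolynomial.C ((-1) ^ l * ((2 * m).choose l : ℂ)) * MvPolynomial.X i.succ ^ l *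
          MvPolynomial.X 0 ^ (2 * m - l) := by
      intro i
      have hsub : Finset.range (2 * m + 1) ⊆ Finset.range L := by
        intro x; simp only [Finset.mem_range]; omega
      rw [← Finset.sum_subset hsub, ← (even_two_mul m).neg_pow, neg_sub, sub_eq_neg_add, add_pow]
      · refine Finset.sum_congr rfl fun l _ => ?_
        rw [neg_pow]
        simp only [MvPolynomial.C_mul, map_pow, map_neg, map_one, map_natCast]
        ring
      · intro l _ hl
        rw [Finset.mem_range] at hl
        rw [Nat.choose_eq_zero_of_lt (by omega)]
        simp
    rw [← Finset.prod_pow, Finset.prod_congr rfl fun i _ => h3 i, Finset.prod_univ_sum,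
      Finset.sum_mul]
    refine Finset.sum_congr rfl fun l _ => ?_
    rw [map_mul, MvPolynomial.monomial_eq, map_mul, MvPolynomial.rename_C,
      Finset.prod_mul_distrib, Finset.prod_mul_distrib, map_prod]
    -- If some l i exceeds 2m, its binomial coefficient is zero. This disposes of all indices for
    -- which the natural subtraction 2m - l i would truncate.
    by_cases hl : ∀ i, l i ≤ 2 * m
    · have h4 : ∏ i, (MvPolynomial.X 0 : MvPolynomial (Fin (k + 1)) ℂ) ^ (2 * m - l i) =
          MvPolynomial.X 0 ^ (2 * m * k - ∑ i, l i) := by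
        rw [Finset.prod_pow_eq_pow_sum, Finset.sum_tsub_distrib _ fun i _ => hl i]
        simp [mul_comm]
      rw [h4, Finsupp.prod_fintype _ _ (by simp), map_prod]
      simp only [map_pow, MvPolynomial.rename_X, Finsupp.equivFunOnFinite_symm_apply_apply]
      ring
    · push Not at hl
      obtain ⟨i, hi⟩ := hl
      have h4 : ∏ i, MvPolynomial.C (σ := Fin (k + 1)) ((-1) ^ l i * ((2 * m).choose (l i) : ℂ)) = 0 :=
        Finset.prod_eq_zero (Finset.mem_univ i) (by rw [Nat.choose_eq_zero_of_lt hi]; simp)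
      rw [h4]
      simp
  rw [h2, map_sum]
  refine Finset.sum_congr rfl fun l hl => ?_
  rw [conv_cons, conv_monomial_mul]
  by_cases hl : ∀ i, l i ≤ 2 * m
  · have h5 : ∑ i, l i ≤ 2 * m * k := by
      calc ∑ i, l i ≤ ∑ _i : Fin k, 2 * m := Finset.sum_le_sum fun i _ => hl i
        _ = 2 * m * k := by simp [mul_comm]
    have h6 : ((∑ i, l i : ℕ) : ℤ) - j - 1 - c = a₀ - (2 * m * k - ∑ i, l i : ℕ) := by
      rw [Nat.cast_sub h5]
      push_cast
      linear_combination h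
    rw [h6, MvPolynomial.smul_eq_C_mul]
    rfl
  · push Not at hl
    obtain ⟨i, hi⟩ := hl
    have h4 : ∏ i, ((-1) ^ l i * ((2 * m).choose (l i) : ℂ)) = 0 :=
      Finset.prod_eq_zero (Finset.mem_univ i) (by rw [Nat.choose_eq_zero_of_lt hi]; simp)
    rw [h4]
    simp

/-- Each further mode adds one variable, and `modeOn_conv` supplies exactly the new factors of the
Vandermonde product. In terms of a_i = p - 1 - j the powers z^{√(2m) h₀} cancel against the shift in
`modeOn_conv`. -/
theorem prod_mode_extremal (m : ℕ) (p : ℤ) (k : ℕ) (a : Fin k → ℤ) :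
    (List.ofFn fun i => mode m (p - 1 - a i)).prod (extremal p) =
      Finsupp.single (-p + 2 * m * k) (conv (creationCoeff m) a (vdm k ^ (2 * m))) := by
  induction k with
  | zero =>
    have : vdm 0 = MvPolynomial.monomial 0 1 := by simp [vdm]
    simp [extremal, this, MvPolynomial.monomial_pow, conv_monomial, -MvPolynomial.monomial_zero']
  | succ k ih =>
    rw [List.ofFn_succ, List.prod_cons, Module.End.mul_apply, ih, mode_single,
      modeOn_conv m k _ _ (a 0) (by ring), vdm_succ, mul_pow, map_pow]
    congr 1
    · push_cast; ring
    · congr 1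
      · congr 1
        exact Fin.cons_self_tail a

/-! ### Diagonal bilinear forms on polynomial rings -/

section wPair

variable {σ : Type*}

/-- The bilinear form for which the monomials are orthogonal, of squared length `w κ`. -/
def wPair (w : (σ →₀ ℕ) → ℂ) : MvPolynomial σ ℂ →ₗ[ℂ] MvPolynomial σ ℂ →ₗ[ℂ] ℂ :=
  (MvPolynomial.basisMonomials σ ℂ).constr ℂ fun κ => w κ • MvPolynomial.lcoeff ℂ κ

theorem wPair_monomial (w : (σ →₀ ℕ) → ℂ) (κ : σ →₀ ℕ) (x : ℂ) (G : MvPolynomial σ ℂ) :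
    wPair w (MvPolynomial.monomial κ x) G = x * (w κ * MvPolynomial.coeff κ G) := by
  have h : MvPolynomial.monomial κ x = x • MvPolynomial.basisMonomials σ ℂ κ := by
    simp [MvPolynomial.smul_monomial]
  rw [h, map_smul, wPair, Module.Basis.constr_basis]
  simp [MvPolynomial.lcoeff]

theorem wPair_eq_sum (w : (σ →₀ ℕ) → ℂ) (F G : MvPolynomial σ ℂ) :
    wPair w F G = ∑ κ ∈ F.support,
      MvPolynomial.coeff κ F * (w κ * MvPolynomial.coeff κ G) := by
  conv_lhs => rw [F.as_sum]
  rw [map_sum, LinearMap.sum_apply]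
  simp only [wPair_monomial]

/-- The pairing of F with its conjugate is ∑ w(κ) |F_κ|² with positive weights. The bilinear form is
used as a Hermitian one in this way. -/
theorem eq_zero_of_wPair_conj (w : (σ →₀ ℕ) → ℂ) (hw : ∀ κ, ∃ r : ℝ, 0 < r ∧ w κ = r)
    (F : MvPolynomial σ ℂ) (h : wPair w F (MvPolynomial.map (starRingEnd ℂ) F) = 0) : F = 0 := by
  choose r hr hwr using hw
  rw [wPair_eq_sum] at h
  have h1 : ∑ κ ∈ F.support, r κ * Complex.normSq (MvPolynomial.coeff κ F) = 0 := by
    rw [← Complex.ofReal_eq_zero, ← h]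
    push_cast
    refine Finset.sum_congr rfl fun κ _ => ?_
    rw [MvPolynomial.coeff_map, hwr, ← Complex.mul_conj]
    ring
  rw [Finset.sum_eq_zero_iff_of_nonneg fun κ _ =>
    mul_nonneg (hr κ).le (Complex.normSq_nonneg _)] at h1
  ext κ
  by_contra hκ
  rw [MvPolynomial.coeff_zero] at hκ
  have h2 := h1 κ (MvPolynomial.mem_support_iff.2 hκ)
  rcases mul_eq_zero.1 h2 with h3 | h3
  · exact (hr κ).ne' h3
  · exact hκ (Complex.normSq_eq_zero.1 h3)

end wPair

/-! ### The contravariant form on Fock space and evaluation at power sums -/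

/-- The squared length of a monomial of Fock space. -/
def fockWeight (κ : ℕ+ →₀ ℕ) : ℂ := κ.prod fun r n => (r : ℂ) ^ n * (n.factorial : ℂ)

theorem fockWeight_add_single (κ : ℕ+ →₀ ℕ) (r : ℕ+) :
    fockWeight (κ + Finsupp.single r 1) = fockWeight κ * (r * (κ r + 1)) := by
  have h0 : ∀ (r : ℕ+), (r : ℂ) ^ 0 * (Nat.factorial 0 : ℂ) = 1 := by simp
  have h1 : Finsupp.erase r (κ + Finsupp.single r 1) = Finsupp.erase r κ := by
    ext s
    rcases eq_or_ne s r with rfl | hs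
    · simp
    · simp [Finsupp.erase_ne hs]
  unfold fockWeight
  rw [← Finsupp.mul_prod_erase' κ r _ h0, ← Finsupp.mul_prod_erase' (κ + Finsupp.single r 1) r _ h0,
    h1]
  simp only [Finsupp.add_apply, Finsupp.single_eq_same, Nat.factorial_succ, pow_succ]
  push_cast
  ring

theorem fockWeight_pos (κ : ℕ+ →₀ ℕ) : ∃ r : ℝ, 0 < r ∧ fockWeight κ = r := by
  refine ⟨κ.prod fun r n => (r : ℝ) ^ n * (n.factorial : ℝ), ?_, ?_⟩
  · refine Finset.prod_pos fun r _ => ?_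
    have := r.pos
    positivity
  · simp [fockWeight, Finsupp.prod]

/-- The bilinear form on Fock space for which `h_n` is adjoint to `h_{-n}`. -/
def fockPair : Fock →ₗ[ℂ] Fock →ₗ[ℂ] ℂ := wPair fockWeight

/-- The Kronecker sequence. -/
def kron (j : ℤ) : ℂ := if j = 0 then 1 else 0

/-- For the constant series 1, `conv` is plain extraction of a coefficient. -/
theorem conv_kron {k : ℕ} (P : MvPolynomial (Fin k) ℂ) (b : Fin k →₀ ℕ) :
    conv kron (fun i => (b i : ℤ)) P = MvPolynomial.coeff b P := by
  induction P using MvPolynomial.induction_on' with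
  | monomial d y =>
    rw [conv_monomial, MvPolynomial.coeff_monomial]
    split_ifs with h
    · subst h; simp [kron]
    · obtain ⟨i, hi⟩ : ∃ i, d i ≠ b i := by
        by_contra hc
        push Not at hc
        exact h (Finsupp.ext hc)
      rw [Finset.prod_eq_zero (Finset.mem_univ i), smul_zero]
      rw [kron, if_neg (by omega)]
  | add p q hp hq => rw [map_add, hp, hq, MvPolynomial.coeff_add]

/-- The evaluation `h_{-r} ↦ x p_r(z_1, …, z_k)` of Fock space at a multiple of the power sums. -/
def powerSums (x : ℂ) (k : ℕ) : Fock →ₐ[ℂ] MvPolynomial (Fin k) ℂ :=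
  MvPolynomial.aeval fun r : ℕ+ => MvPolynomial.C x * MvPolynomial.psum (Fin k) ℂ r

theorem derivation_prod {A B ι : Type*} [CommRing A] [CommRing B] [Algebra A B] [DecidableEq ι]
    (D : Derivation A B B) (s : Finset ι) (f : ι → B) :
    D (∏ i ∈ s, f i) = ∑ i ∈ s, (∏ j ∈ s.erase i, f j) * D (f i) := by
  induction s using Finset.induction_on with
  | empty => simp
  | insert a s ha ih =>
    rw [Finset.prod_insert ha, Derivation.leibniz, ih, Finset.sum_insert ha,
      Finset.erase_insert ha, smul_eq_mul, smul_eq_mul, Finset.mul_sum, add_comm]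
    congr 1
    refine Finset.sum_congr rfl fun i hi => ?_
    have hia : a ≠ i := fun h => ha (h ▸ hi)
    rw [Finset.erase_insert_of_ne hia, Finset.prod_insert (by simp [ha]), mul_assoc]

theorem pderiv_prod_creationCoeff (m k : ℕ) (r : ℕ+) (a : Fin k → ℤ) :
    (r : ℂ) • MvPolynomial.pderiv r (∏ i, creationCoeff m (a i)) =
      sqrtTwo m • ∑ i, ∏ j, creationCoeff m (a j - (Finsupp.single i (r : ℕ) : Fin k →₀ ℕ) j) := by
  rw [derivation_prod, Finset.smul_sum, Finset.smul_sum]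
  refine Finset.sum_congr rfl fun i _ => ?_
  have h := pderiv_creationCoeff m r (a i)
  rw [← MvPolynomial.smul_eq_C_mul, ← MvPolynomial.smul_eq_C_mul] at h
  rw [← mul_smul_comm, h, ← Finset.mul_prod_erase _ _ (Finset.mem_univ i),
    mul_smul_comm, mul_comm]
  congr 2
  · simp
  · refine Finset.prod_congr rfl fun j hj => ?_
    rw [Finsupp.single_eq_of_ne (Finset.ne_of_mem_erase hj)]
    simp

theorem fockPair_mul_X (F G : Fock) (r : ℕ+) :
    fockPair (F * MvPolynomial.X r) G = fockPair F ((r : ℂ) • MvPolynomial.pderiv r G) := by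
  induction F using MvPolynomial.induction_on' with
  | monomial κ y =>
    rw [MvPolynomial.X, MvPolynomial.monomial_mul, fockPair, wPair_monomial, wPair_monomial,
      fockWeight_add_single, MvPolynomial.coeff_smul, MvPolynomial.coeff_pderiv, smul_eq_mul]
    ring
  | add p q hp hq =>
    rw [add_mul, map_add, LinearMap.add_apply, hp, hq, map_add, LinearMap.add_apply]

/-- Each factor h_{-r} of F moves to the other side as r ∂/∂h_{-r}, which multiplies ∏ E(z_i) by
√(2m) p_r(z). What is left is the pairing with 1, that is, the constant term, where each E(z_i)
reduces to 1. -/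
theorem fockPair_prod (m k : ℕ) (F : Fock) (a : Fin k → ℤ) :
    fockPair F (∏ i, creationCoeff m (a i)) = conv kron a (powerSums (sqrtTwo m) k F) := by
  induction F using MvPolynomial.induction_on generalizing a with
  | C y =>
    have h := MvPolynomial.algHom_C (powerSums (sqrtTwo m) k) y
    rw [h, MvPolynomial.algebraMap_eq, MvPolynomial.C_apply, MvPolynomial.C_apply, conv_monomial,
      fockPair, wPair_monomial, ← MvPolynomial.constantCoeff_eq, map_prod]
    simp [constantCoeff_creationCoeff, fockWeight, kron]
  | add p q hp hq => rw [map_add, map_add, map_add, LinearMap.add_apply, hp, hq]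
  | mul_X p r ih =>
    have h1 : powerSums (sqrtTwo m) k (MvPolynomial.X r) =
        ∑ i, MvPolynomial.monomial (Finsupp.single i (r : ℕ)) (sqrtTwo m) := by
      rw [powerSums, MvPolynomial.aeval_X, MvPolynomial.psum, Finset.mul_sum]
      refine Finset.sum_congr rfl fun i _ => ?_
      rw [MvPolynomial.X_pow_eq_monomial, MvPolynomial.C_mul_monomial, mul_one]
    rw [fockPair_mul_X, pderiv_prod_creationCoeff, map_smul, map_sum, map_mul, h1,
      Finset.mul_sum, map_sum, Finset.smul_sum]
    refine Finset.sum_congr rfl fun i _ => ?_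
    rw [ih, mul_comm, conv_monomial_mul]

theorem fockPair_conv (m k : ℕ) (F : Fock) (a : Fin k → ℤ) (Q : MvPolynomial (Fin k) ℂ) :
    fockPair F (conv (creationCoeff m) a Q) =
      conv kron a (Q * powerSums (sqrtTwo m) k F) := by
  induction Q using MvPolynomial.induction_on' with
  | monomial d y => rw [conv_monomial, map_smul, conv_monomial_mul, fockPair_prod]
  | add p q hp hq => rw [map_add, add_mul, map_add, map_add, hp, hq]

/-! ### Degrees -/

/-- The degree of `h_{-r}`. -/
def modeWeight (r : ℕ+) : ℕ := r

theorem isWeightedHomogeneous_creationCoeff (m n : ℕ) :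
    (creationCoeff m n).IsWeightedHomogeneous modeWeight n := by
  induction n using Nat.strong_induction_on with
  | _ n ih =>
  rcases n with _ | n
  · rw [Nat.cast_zero, creationCoeff_zero]
    exact MvPolynomial.isWeightedHomogeneous_one _ _
  · have h1 : creationCoeff m (n + 1 : ℕ) = (∑ i ∈ Finset.range (n + 1),
        MvPolynomial.C (sqrtTwo m) * (MvPolynomial.X i.succPNat : Fock) *
          creationCoeff m (n - i : ℕ)) * MvPolynomial.C ((n + 1 : ℂ)⁻¹) := by
      have h2 : (n + 1 : Fock) = MvPolynomial.C (n + 1 : ℂ) := by simp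
      have hn : (n + 1 : ℂ) ≠ 0 := by exact_mod_cast Nat.succ_ne_zero n
      rw [← creationCoeff_succ, h2, mul_assoc, ← MvPolynomial.C_mul, mul_inv_cancel₀ hn]
      simp
    rw [h1, mul_comm]
    refine MvPolynomial.IsWeightedHomogeneous.C_mul
      (MvPolynomial.IsWeightedHomogeneous.sum _ _ _ fun i hi => ?_) _
    rw [Finset.mem_range] at hi
    have h3 := ((MvPolynomial.isWeightedHomogeneous_X ℂ modeWeight i.succPNat).C_mul
      (sqrtTwo m)).mul (ih (n - i) (by omega))
    have h4 : modeWeight i.succPNat + (n - i) = n + 1 := by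
      rw [modeWeight, Nat.succPNat_coe]; omega
    rwa [h4] at h3

section conv

variable {R : Type*} [CommRing R] [Algebra ℂ R] {k : ℕ}

theorem conv_eq_sum (e : ℤ → R) (a : Fin k → ℤ) (Q : MvPolynomial (Fin k) ℂ) :
    conv e a Q = ∑ c ∈ Q.support, Q.coeff c • ∏ i, e (a i - c i) := by
  conv_lhs => rw [Q.as_sum]
  rw [map_sum]
  simp only [conv_monomial]

/-- Every monomial of Q has degree larger than ∑ a_i, so some index a_i - c_i is negative. -/
theorem conv_eq_zero_of_homogeneous (e : ℤ → R) (he : ∀ j < 0, e j = 0) (a : Fin k → ℤ) {D : ℕ}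
    {Q : MvPolynomial (Fin k) ℂ} (hQ : Q.IsHomogeneous D) (ha : ∑ i, a i < D) :
    conv e a Q = 0 := by
  rw [conv_eq_sum]
  refine Finset.sum_eq_zero fun c hc => ?_
  have h1 : ∑ i, c i = D := by
    rw [← hQ (MvPolynomial.mem_support_iff.1 hc), Finsupp.weight_apply, Finsupp.sum_fintype] <;> simp
  have h2 : ∃ i, a i - c i < 0 := by
    by_contra! h
    have := Finset.sum_nonneg fun i (_ : i ∈ Finset.univ) => h i
    rw [Finset.sum_sub_distrib] at this
    have h3 : ((∑ i, c i : ℕ) : ℤ) = D := by rw [h1]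
    push_cast at h3
    omega
  obtain ⟨i, hi⟩ := h2
  rw [Finset.prod_eq_zero (Finset.mem_univ i) (he _ hi), smul_zero]

end conv

theorem isWeightedHomogeneous_conv (m : ℕ) {k : ℕ} (a : Fin k → ℤ) {D d : ℕ}
    {Q : MvPolynomial (Fin k) ℂ} (hQ : Q.IsHomogeneous D) (ha : ∑ i, a i = D + d) :
    (conv (creationCoeff m) a Q).IsWeightedHomogeneous modeWeight d := by
  rw [conv_eq_sum]
  refine MvPolynomial.IsWeightedHomogeneous.sum _ _ _ fun c hc => ?_
  rw [MvPolynomial.smul_eq_C_mul]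
  refine MvPolynomial.IsWeightedHomogeneous.C_mul ?_ _
  by_cases h : ∀ i, 0 ≤ a i - c i
  · have h1 : ∑ i, c i = D := by
      rw [← hQ (MvPolynomial.mem_support_iff.1 hc), Finsupp.weight_apply, Finsupp.sum_fintype] <;>
        simp
    choose b hb using fun i => Int.eq_ofNat_of_zero_le (h i)
    have h2 : ∑ i, b i = d := by
      have h3 : ((∑ i, b i : ℕ) : ℤ) = (∑ i, a i) - ((∑ i, c i : ℕ) : ℤ) := by
        push_cast
        rw [← Finset.sum_sub_distrib]
        exact Finset.sum_congr rfl fun i _ => (hb i).symm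
      rw [h1, ha] at h3
      omega
    rw [← h2]
    refine MvPolynomial.IsWeightedHomogeneous.prod _ _ _ fun i _ => ?_
    rw [hb]
    exact isWeightedHomogeneous_creationCoeff m (b i)
  · push Not at h
    obtain ⟨i, hi⟩ := h
    rw [Finset.prod_eq_zero (Finset.mem_univ i) (creationCoeff_of_neg m hi)]
    exact MvPolynomial.isWeightedHomogeneous_zero _ _ _

theorem isHomogeneous_vdm (k : ℕ) : (vdm k).IsHomogeneous (k.choose 2) := by
  induction k with
  | zero => simpa [vdm] using MvPolynomial.isHomogeneous_one (Fin 0) ℂ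
  | succ k ih =>
    rw [vdm_succ, Nat.choose_succ_succ' k 1, Nat.choose_one_right]
    refine MvPolynomial.IsHomogeneous.mul ?_ (ih.rename_isHomogeneous)
    have h := MvPolynomial.IsHomogeneous.prod (Finset.univ : Finset (Fin k))
      (fun j => (MvPolynomial.X j.succ - MvPolynomial.X 0 : MvPolynomial (Fin (k + 1)) ℂ))
      (fun _ => 1) fun j _ =>
        (MvPolynomial.isHomogeneous_X ℂ _).sub (MvPolynomial.isHomogeneous_X ℂ _)
    simpa using h

theorem isHomogeneous_vdm_pow (k N : ℕ) : (vdm k ^ N).IsHomogeneous (k.choose 2 * N) :=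
  (isHomogeneous_vdm k).pow N

theorem vdm_ne_zero (k : ℕ) : vdm k ≠ 0 := by
  rw [vdm, Finset.prod_ne_zero_iff]
  intro i _
  rw [Finset.prod_ne_zero_iff]
  intro j hj h
  rw [sub_eq_zero] at h
  exact (Finset.mem_Ioi.1 hj).ne' (MvPolynomial.X_injective h)

/-! ### Evaluation at power sums -/

theorem powerSums_X (x : ℂ) (k : ℕ) (r : ℕ+) : powerSums x k (MvPolynomial.X r) =
    MvPolynomial.C x * MvPolynomial.psum (Fin k) ℂ r :=
  MvPolynomial.aeval_X _ _

theorem isSymmetric_powerSums (x : ℂ) (k : ℕ) (F : Fock) : (powerSums x k F).IsSymmetric := by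
  intro e
  have h : (MvPolynomial.rename e).comp (powerSums x k) = powerSums x k := by
    refine MvPolynomial.algHom_ext fun r => ?_
    rw [AlgHom.comp_apply, powerSums_X, map_mul, MvPolynomial.rename_C, MvPolynomial.rename_psum]
  exact DFunLike.congr_fun h F

theorem isHomogeneous_powerSums (x : ℂ) (k d : ℕ) (F : Fock)
    (hF : F.IsWeightedHomogeneous modeWeight d) : (powerSums x k F).IsHomogeneous d := by
  rw [F.as_sum, map_sum]
  refine MvPolynomial.IsHomogeneous.sum _ _ _ fun κ hκ => ?_
  have h1 : powerSums x k (MvPolynomial.monomial κ (F.coeff κ)) =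
      MvPolynomial.C (F.coeff κ) * ∏ r ∈ κ.support, (MvPolynomial.C x *
        MvPolynomial.psum (Fin k) ℂ r) ^ κ r := by
    rw [powerSums, MvPolynomial.aeval_monomial, MvPolynomial.algebraMap_eq, Finsupp.prod]
  have h2 : d = ∑ r ∈ κ.support, (r : ℕ) * κ r := by
    rw [← hF (MvPolynomial.mem_support_iff.1 hκ), Finsupp.weight_apply, Finsupp.sum]
    refine Finset.sum_congr rfl fun r _ => ?_
    rw [modeWeight, smul_eq_mul, mul_comm]
  rw [h1, h2]
  refine MvPolynomial.IsHomogeneous.C_mul (MvPolynomial.IsHomogeneous.prod _ _ _ fun r _ => ?_) _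
  refine MvPolynomial.IsHomogeneous.pow (MvPolynomial.IsHomogeneous.C_mul ?_ _) _
  refine MvPolynomial.IsHomogeneous.sum _ _ _ fun i _ => ?_
  exact MvPolynomial.isHomogeneous_X_pow i _

/-- Newton's identities express the elementary symmetric polynomials through power sums in
characteristic zero, and the elementary ones generate all symmetric polynomials. -/
theorem mem_range_powerSums {x : ℂ} (hx : x ≠ 0) (k : ℕ) (P : MvPolynomial (Fin k) ℂ)
    (hP : P.IsSymmetric) : P ∈ (powerSums x k).range := by
  have hps : ∀ r : ℕ+, MvPolynomial.psum (Fin k) ℂ r ∈ (powerSums x k).range := by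
    intro r
    refine ⟨x⁻¹ • MvPolynomial.X r, ?_⟩
    change powerSums x k _ = _
    rw [map_smul, powerSums_X, ← MvPolynomial.smul_eq_C_mul, smul_smul, inv_mul_cancel₀ hx,
      one_smul]
  have hes : ∀ j : ℕ, MvPolynomial.esymm (Fin k) ℂ j ∈ (powerSums x k).range := by
    intro j
    induction j using Nat.strong_induction_on with
    | _ j ih =>
    rcases Nat.eq_zero_or_pos j with rfl | hj
    · rw [MvPolynomial.esymm_zero]; exact one_mem _
    · have h := MvPolynomial.mul_esymm_eq_sum (Fin k) ℂ j
      have hj' : (j : ℂ) ≠ 0 := by exact_mod_cast hj.ne'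
      have h1 : MvPolynomial.esymm (Fin k) ℂ j = (j : ℂ)⁻¹ • ((j : MvPolynomial (Fin k) ℂ) *
          MvPolynomial.esymm (Fin k) ℂ j) := by
        rw [← nsmul_eq_mul, ← Nat.cast_smul_eq_nsmul ℂ, smul_smul, inv_mul_cancel₀ hj', one_smul]
      rw [h1, h]
      refine Subalgebra.smul_mem _ (mul_mem (pow_mem (neg_mem (one_mem _)) _)
        (sum_mem fun a ha => ?_)) _
      rw [Finset.mem_filter, Finset.HasAntidiagonal.mem_antidiagonal] at ha
      exact mul_mem (mul_mem (pow_mem (neg_mem (one_mem _)) _) (ih _ ha.2)) (hps ⟨a.2, by omega⟩)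
  obtain ⟨q, hq⟩ := MvPolynomial.esymmAlgHom_surjective (σ := Fin k) ℂ (n := k) (by simp) ⟨P, hP⟩
  have hq' : P = MvPolynomial.aeval
      (fun i : Fin k => MvPolynomial.esymm (Fin k) ℂ (i + 1)) q := by
    rw [← MvPolynomial.esymmAlgHom_apply, hq]
  rw [hq']
  clear hq' hq
  induction q using MvPolynomial.induction_on with
  | C y => rw [MvPolynomial.algHom_C]; exact Subalgebra.algebraMap_mem _ _
  | add p q hp hq => rw [map_add]; exact add_mem hp hq
  | mul_X p i hp => rw [map_mul, MvPolynomial.aeval_X]; exact mul_mem hp (hes _)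

/-! ### Injectivity of the evaluation -/

/-- The span of the coefficients of a product of `k` creation series. -/
def creationSpan (m k : ℕ) : Submodule ℂ Fock :=
  Submodule.span ℂ (Set.range fun a : Fin k → ℤ => ∏ i, creationCoeff m (a i))

theorem conv_mem_creationSpan (m : ℕ) {k : ℕ} (a : Fin k → ℤ) (Q : MvPolynomial (Fin k) ℂ) :
    conv (creationCoeff m) a Q ∈ creationSpan m k := by
  rw [conv_eq_sum]
  exact sum_mem fun c _ => Submodule.smul_mem _ _ (Submodule.subset_span ⟨_, rfl⟩)

/-- The generators have real coefficients because √(2m) is real. -/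
theorem conj_mem_creationSpan {m k : ℕ} {u : Fock} (hu : u ∈ creationSpan m k) :
    MvPolynomial.map (starRingEnd ℂ) u ∈ creationSpan m k := by
  induction hu using Submodule.span_induction with
  | mem x hx =>
    obtain ⟨a, rfl⟩ := hx
    simp only [map_prod, map_conj_creationCoeff]
    exact Submodule.subset_span ⟨a, rfl⟩
  | zero => simp
  | add x y _ _ hx hy => rw [map_add]; exact add_mem hx hy
  | smul c x _ hx =>
    rw [MvPolynomial.smul_eq_C_mul, map_mul, MvPolynomial.map_C, ← MvPolynomial.smul_eq_C_mul]
    exact Submodule.smul_mem _ _ hx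

/-- The rescaling `h_{-r} ↦ h_{-r} / 2`. -/
def halve : Fock →ₐ[ℂ] Fock := MvPolynomial.aeval fun r : ℕ+ => (2⁻¹ : ℂ) • MvPolynomial.X r

theorem powerSums_halve (x : ℂ) (k : ℕ) (F : Fock) :
    powerSums x k (halve F) = powerSums (x / 2) k F := by
  have h : (powerSums x k).comp halve = powerSums (x / 2) k := by
    refine MvPolynomial.algHom_ext fun r => ?_
    rw [AlgHom.comp_apply, powerSums_X, halve, MvPolynomial.aeval_X, map_smul, powerSums_X,
      MvPolynomial.smul_eq_C_mul, ← mul_assoc, ← MvPolynomial.C_mul, div_eq_inv_mul]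
  exact DFunLike.congr_fun h F

theorem fockPair_halve (F G : Fock) :
    fockPair (halve F) G = wPair (fun κ => (2⁻¹ : ℂ) ^ κ.degree * fockWeight κ) F G := by
  induction F using MvPolynomial.induction_on' with
  | monomial κ y =>
    have h1 : halve (MvPolynomial.monomial κ y) =
        MvPolynomial.monomial κ (y * (2⁻¹ : ℂ) ^ κ.degree) := by
      rw [halve, MvPolynomial.aeval_monomial, MvPolynomial.monomial_eq (a := y * _),
        MvPolynomial.algebraMap_eq, MvPolynomial.C_mul, mul_assoc]
      congr 1
      simp only [Finsupp.prod, MvPolynomial.smul_eq_C_mul, mul_pow, ← MvPolynomial.C_pow,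
        Finset.prod_mul_distrib]
      rw [← map_prod, Finset.prod_pow_eq_pow_sum, Finsupp.degree_apply]
    rw [h1, fockPair, wPair_monomial, wPair_monomial]
    ring
  | add p q hp hq =>
    rw [map_add, map_add, LinearMap.add_apply, hp, hq, map_add, LinearMap.add_apply]

/-- By `fockPair_prod` the rescaled vector `halve u` is orthogonal to all products of k creation
coefficients, hence to the conjugate of u, which lies in the same span. That pairing is definite:
rescaling only changes the weight by 2^{-deg}. -/
theorem eq_zero_of_powerSums_eq_zero {m k : ℕ} {u : Fock} (hu : u ∈ creationSpan m k)
    (h : powerSums (sqrtTwo m / 2) k u = 0) : u = 0 := by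
  have h1 : ∀ s ∈ creationSpan m k, fockPair (halve u) s = 0 := by
    intro s hs
    induction hs using Submodule.span_induction with
    | mem x hx =>
      obtain ⟨a, rfl⟩ := hx
      simp only [fockPair_prod, powerSums_halve, h, map_zero]
    | zero => simp
    | add x y _ _ hx hy => rw [map_add, hx, hy, add_zero]
    | smul c x _ hx => rw [map_smul, hx, smul_zero]
  have h2 := h1 _ (conj_mem_creationSpan hu)
  rw [fockPair_halve] at h2
  refine eq_zero_of_wPair_conj _ (fun κ => ?_) u h2
  obtain ⟨r, hr, hr'⟩ := fockWeight_pos κ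
  exact ⟨2⁻¹ ^ κ.degree * r, by positivity, by rw [hr']; push_cast; ring⟩

/-! ### Nondegeneracy -/

section reflection

variable {k : ℕ}

/-- With all weights 1 the form is the constant term of A(z) B(1/z), so a variable acts as an
isometry. -/
theorem wPair_one_X_mul (j : Fin k) (A B : MvPolynomial (Fin k) ℂ) :
    wPair 1 (MvPolynomial.X j * A) (MvPolynomial.X j * B) = wPair 1 A B := by
  induction A using MvPolynomial.induction_on' with
  | monomial κ y =>
    rw [MvPolynomial.X, MvPolynomial.monomial_mul, wPair_monomial, wPair_monomial,
      MvPolynomial.coeff_monomial_mul]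
    simp
  | add p q hp hq =>
    rw [mul_add, map_add, LinearMap.add_apply, hp, hq, map_add, LinearMap.add_apply]

/-- Multiplication by `V` is, up to a shift by `M` and a nonzero factor, self-adjoint. -/
def ReflectsTo (M V : MvPolynomial (Fin k) ℂ) : Prop :=
  ∃ s : ℂ, s ≠ 0 ∧ ∀ A B, wPair 1 (M * A) (V * B) = s * wPair 1 (V * A) B

theorem ReflectsTo.one : ReflectsTo (1 : MvPolynomial (Fin k) ℂ) 1 :=
  ⟨1, one_ne_zero, fun A B => by simp⟩

theorem ReflectsTo.mul {M V M' V' : MvPolynomial (Fin k) ℂ} (h : ReflectsTo M V)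
    (h' : ReflectsTo M' V') : ReflectsTo (M * M') (V * V') := by
  obtain ⟨s, hs, h⟩ := h
  obtain ⟨s', hs', h'⟩ := h'
  refine ⟨s * s', mul_ne_zero hs hs', fun A B => ?_⟩
  rw [mul_assoc, mul_assoc, h, mul_left_comm V, h', mul_assoc, mul_left_comm V', mul_assoc V]

theorem ReflectsTo.prod {ι : Type*} (s : Finset ι) (M V : ι → MvPolynomial (Fin k) ℂ)
    (h : ∀ i ∈ s, ReflectsTo (M i) (V i)) : ReflectsTo (∏ i ∈ s, M i) (∏ i ∈ s, V i) := by
  classical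
  induction s using Finset.induction_on with
  | empty => simpa using ReflectsTo.one
  | insert a s ha ih =>
    rw [Finset.prod_insert ha, Finset.prod_insert ha]
    exact (h a (by simp)).mul (ih fun i hi => h i (by simp [hi]))

/-- The reason is z_i z_j (1/z_j - 1/z_i) = -(z_j - z_i), whence the factor -1. -/
theorem ReflectsTo.X_sub_X (i j : Fin k) :
    ReflectsTo (MvPolynomial.X i * MvPolynomial.X j)
      (MvPolynomial.X j - MvPolynomial.X i : MvPolynomial (Fin k) ℂ) := by
  refine ⟨-1, by simp, fun A B => ?_⟩
  have h1 := wPair_one_X_mul j (MvPolynomial.X i * A) B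
  have h2 := wPair_one_X_mul i (MvPolynomial.X j * A) B
  rw [← mul_assoc] at h1 h2
  rw [mul_comm (MvPolynomial.X j)] at h1
  rw [sub_mul, map_sub, h1, h2, sub_mul, map_sub, LinearMap.sub_apply]
  ring

theorem prod_X_mul_X (k : ℕ) :
    ∏ i : Fin k, ∏ j ∈ Finset.Ioi i, (MvPolynomial.X i * MvPolynomial.X j) =
      (MvPolynomial.monomial (Finsupp.equivFunOnFinite.symm fun _ => k - 1) 1 :
        MvPolynomial (Fin k) ℂ) := by
  simp only [Finset.prod_mul_distrib, Finset.prod_const, Fin.card_Ioi]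
  rw [Finset.prod_comm' (t' := Finset.univ) (s' := fun j => Finset.Iio j) (by simp)]
  simp only [Finset.prod_const, Fin.card_Iio]
  rw [← Finset.prod_mul_distrib, MvPolynomial.monomial_eq, Finsupp.prod_fintype _ _ (by simp)]
  simp only [← pow_add, map_one, one_mul, Finsupp.equivFunOnFinite_symm_apply_apply]
  refine Finset.prod_congr rfl fun i _ => ?_
  congr 1
  omega

theorem reflectsTo_vdm_pow (k m : ℕ) :
    ReflectsTo (MvPolynomial.monomial (Finsupp.equivFunOnFinite.symm fun _ => m * (k - 1)) 1)
      (vdm k ^ m) := by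
  have h1 : ReflectsTo _ (vdm k) := ReflectsTo.prod Finset.univ _ _ fun i _ =>
    ReflectsTo.prod (Finset.Ioi i) _ _ fun j _ => ReflectsTo.X_sub_X i j
  rw [prod_X_mul_X] at h1
  have h2 := ReflectsTo.prod (Finset.range m) _ _ fun _ _ => h1
  rw [Finset.prod_const, Finset.prod_const, Finset.card_range, MvPolynomial.monomial_pow,
    one_pow] at h2
  convert h2 using 3
  ext i
  simp

theorem map_conj_vdm (k : ℕ) : MvPolynomial.map (starRingEnd ℂ) (vdm k) = vdm k := by
  simp [vdm]

theorem starRingEnd_comp_self : (starRingEnd ℂ).comp (starRingEnd ℂ) = RingHom.id ℂ := by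
  ext x
  simp

/-- Put V = `vdm k` and M = ∏ z_i^{m(k-1)}. Reflection gives ⟨M τ̄, V^{2m} τ⟩ = s ⟨V^m τ̄, V^m τ⟩.
The left side only sees coefficients at exponents below n, so it vanishes. The right side is s times
the squared norm of V^m τ, because V is real. Hence V^m τ = 0. -/
theorem eq_zero_of_coeff_vdm_mul {m n : ℕ} (τ : MvPolynomial (Fin k) ℂ)
    (hτ : ∀ c ∈ τ.support, ∀ i, c i + m * (k - 1) < n)
    (h : ∀ a : Fin k →₀ ℕ, (∀ i, a i < n) → (vdm k ^ (2 * m) * τ).coeff a = 0) : τ = 0 := by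
  obtain ⟨s, hs, h1⟩ := reflectsTo_vdm_pow k m
  have h2 := h1 (MvPolynomial.map (starRingEnd ℂ) τ) (vdm k ^ m * τ)
  rw [← mul_assoc, ← pow_add, ← two_mul, wPair_eq_sum, Finset.sum_eq_zero] at h2
  · have h3 : vdm k ^ m * τ = MvPolynomial.map (starRingEnd ℂ)
        (vdm k ^ m * MvPolynomial.map (starRingEnd ℂ) τ) := by
      rw [map_mul, map_pow, map_conj_vdm, MvPolynomial.map_map, starRingEnd_comp_self,
        MvPolynomial.map_id]
    rw [h3] at h2
    have h4 := eq_zero_of_wPair_conj 1 (fun _ => ⟨1, one_pos, by simp⟩) _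
      ((mul_eq_zero.1 h2.symm).resolve_left hs)
    rw [h4, map_zero] at h3
    exact (mul_eq_zero.1 h3).resolve_left (pow_ne_zero _ (vdm_ne_zero k))
  · intro κ hκ
    rw [h, mul_zero, mul_zero]
    intro i
    rw [MvPolynomial.mem_support_iff, MvPolynomial.coeff_monomial_mul'] at hκ
    split_ifs at hκ with hle
    · rw [MvPolynomial.coeff_map] at hκ
      have h5 : (κ - Finsupp.equivFunOnFinite.symm fun _ => m * (k - 1)) ∈ τ.support := by
        rw [MvPolynomial.mem_support_iff]
        intro h0
        rw [h0] at hκ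
        simp at hκ
      have h6 := hτ _ h5 i
      have h7 := hle i
      simp only [Finsupp.tsub_apply, Finsupp.equivFunOnFinite_symm_apply_apply] at h6 h7
      omega
    · exact absurd rfl hκ

end reflection

/-! ### The degree bound -/

/-- In every term of the binomial expansion one of the two exponents is at least m. -/
theorem sub_pow_eq_add {R : Type*} [CommRing R] (x y : R) (m : ℕ) :
    ∃ α β, (x - y) ^ (2 * m) = α * x ^ m + β * y ^ m := by
  have h : (x + -y) ^ (2 * m) ∈ Ideal.span {x ^ m, y ^ m} := by
    refine Ideal.add_pow_mem_of_pow_mem_of_le _ (m := m) (n := m)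
      (Ideal.subset_span (by simp)) ?_ (by omega)
    rw [neg_pow]
    exact Ideal.mul_mem_left _ _ (Ideal.subset_span (by simp))
  obtain ⟨α, β, h⟩ := Ideal.mem_span_pair.1 h
  exact ⟨α, β, by rw [h, sub_eq_add_neg]⟩

/-- Induction on the number of variables. In the i-th term of the previous sum only x_i^m is
missing; splitting (x_i - x_0)^{2m} into multiples of x_i^m and x_0^m supplies the missing power or
the power of the new variable. -/
theorem prod_sub_pow_eq_sum {R : Type*} [CommRing R] (m k : ℕ) (x : Fin (k + 1) → R) :
    ∃ B : Fin (k + 1) → R, (∏ i, ∏ j ∈ Finset.Ioi i, (x j - x i)) ^ (2 * m) =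
      ∑ i, B i * ∏ j ∈ Finset.univ.erase i, x j ^ m := by
  suffices h : (∏ i, ∏ j ∈ Finset.Ioi i, (x j - x i)) ^ (2 * m) ∈
      Ideal.span (Set.range fun i => ∏ j ∈ Finset.univ.erase i, x j ^ m) by
    obtain ⟨B, hB⟩ := Ideal.mem_span_range_iff_exists_fun.1 h
    exact ⟨B, hB.symm⟩
  induction k with
  | zero =>
    have h1 : ∏ j ∈ Finset.univ.erase (0 : Fin 1), x j ^ m = 1 := by simp
    rw [Ideal.eq_top_of_unit_mem _ 1 1 (Ideal.subset_span (Set.mem_range.2 ⟨0, h1⟩)) (one_mul 1)]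
    trivial
  | succ k ih =>
    obtain ⟨B, hB⟩ := Ideal.mem_span_range_iff_exists_fun.1 (ih fun i => x i.succ)
    rw [Fin.prod_univ_succ, Fin.prod_Ioi_zero, mul_pow]
    simp only [Fin.prod_Ioi_succ]
    rw [← hB, Finset.mul_sum]
    refine sum_mem fun i _ => ?_
    obtain ⟨α, β, h1⟩ := sub_pow_eq_add (x i.succ) (x 0) m
    rw [← Finset.prod_pow, ← Finset.mul_prod_erase _ _ (Finset.mem_univ i), h1]
    have h2 : x i.succ ^ m * ∏ j ∈ Finset.univ.erase i, x j.succ ^ m =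
        ∏ j ∈ Finset.univ.erase 0, x j ^ m := by
      rw [Finset.mul_prod_erase _ (fun j : Fin (k + 1) => x j.succ ^ m) (Finset.mem_univ i)]
      have h0 : Finset.univ.erase (0 : Fin (k + 2)) = Finset.univ.map (Fin.succEmb (k + 1)) := by
        ext j
        cases j using Fin.cases <;> simp [Fin.succ_ne_zero]
      rw [h0, Finset.prod_map]
      rfl
    have h3 : x 0 ^ m * ∏ j ∈ Finset.univ.erase i, x j.succ ^ m =
        ∏ j ∈ Finset.univ.erase i.succ, x j ^ m := by
      have h0 : Finset.univ.erase i.succ =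
          insert 0 ((Finset.univ.erase i).map (Fin.succEmb (k + 1))) := by
        ext j
        cases j using Fin.cases <;> simp [Fin.succ_ne_zero, (Fin.succ_ne_zero _).symm]
      rw [h0, Finset.prod_insert (by simp [Fin.succ_ne_zero]), Finset.prod_map]
      rfl
    have h4 := Ideal.mul_mem_left _ α (Ideal.subset_span
      (Set.mem_range_self (f := fun i => ∏ j ∈ Finset.univ.erase i, x j ^ m) 0))
    have h5 := Ideal.mul_mem_left _ β (Ideal.subset_span
      (Set.mem_range_self (f := fun i => ∏ j ∈ Finset.univ.erase i, x j ^ m) i.succ))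
    have h6 := Ideal.mul_mem_left _ (B i * ∏ j ∈ Finset.univ.erase i, (x j.succ - x 0) ^ (2 * m))
      (add_mem h4 h5)
    convert h6 using 1
    rw [← h2, ← h3]
    ring

theorem natDegree_X_sub_C_pow_le {R : Type*} [CommRing R] (x : R) (m : ℕ) :
    ((X - C x) ^ m : R[X]).natDegree ≤ m := by
  simpa using natDegree_pow_le_of_le m (natDegree_X_sub_C_le x)

theorem reflect_X_sub_C_pow {R : Type*} [CommRing R] [Nontrivial R] (x : R) (m : ℕ) :
    (((X - C x) ^ m).reflect m : R[X]) = (1 - C x * X) ^ m := by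
  induction m with
  | zero => simp
  | succ m ih =>
    have h : (X - C x : R[X]).reflect 1 = 1 - C x * X := by
      rw [sub_eq_add_neg, ← C_neg, reflect_add, reflect_one_X, reflect_C, C_neg]
      ring
    rw [pow_succ, reflect_mul _ _ (natDegree_X_sub_C_pow_le x m)
      (natDegree_X_sub_C_le x), ih, h, pow_succ]

theorem reflect_prod_X_sub_C_pow {R ι : Type*} [CommRing R] [Nontrivial R] (x : ι → R) (m : ℕ)
    (s : Finset ι) : (∏ j ∈ s, (X - C (x j)) ^ m : R[X]).natDegree ≤ m * s.card ∧
    (∏ j ∈ s, (X - C (x j)) ^ m : R[X]).reflect (m * s.card) = ∏ j ∈ s, (1 - C (x j) * X) ^ m := by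
  classical
  induction s using Finset.induction_on with
  | empty => simp
  | insert a s ha ih =>
    have hd : ((X - C (x a)) ^ m : R[X]).natDegree ≤ m := natDegree_X_sub_C_pow_le _ m
    rw [Finset.prod_insert ha, Finset.prod_insert ha, Finset.card_insert_of_notMem ha, mul_add,
      mul_one, add_comm]
    refine ⟨natDegree_mul_le_of_le hd ih.1, ?_⟩
    rw [reflect_mul _ _ hd ih.1, ih.2, reflect_X_sub_C_pow]

theorem coe_one_sub_C_mul_X {R : Type*} [CommRing R] (x : R) :
    ((1 - C x * X : R[X]) : PowerSeries R) = oneSub x := by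
  simp [oneSub]

/-- Differences of T - z_j do not involve T, so `prod_sub_pow_eq_sum` writes V^{2m} = ∑ B_i(T)
∏_{j≠i} (T - z_j)^m. Reversing in T and multiplying by ∏ (1 - z_j T)^{-m} leaves, up to a power of
T, the sum of reversed B_i times (1 - z_i T)^{-m}, whose high coefficients contain high powers of a
single z_i. -/
theorem vdm_pow_mul_coeff_mem (m k n r : ℕ) (hr : n ≤ r + m * k) :
    vdm (k + 1) ^ (2 * m) * PowerSeries.coeff r (∏ i : Fin (k + 1),
        oneSubInvPow (MvPolynomial.X i : MvPolynomial (Fin (k + 1)) ℂ) m) ∈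
      Ideal.span (Set.range fun i : Fin (k + 1) =>
        (MvPolynomial.X i : MvPolynomial (Fin (k + 1)) ℂ) ^ n) := by
  set H : PowerSeries (MvPolynomial (Fin (k + 1)) ℂ) := ∏ i : Fin (k + 1), oneSubInvPow (MvPolynomial.X i : MvPolynomial (Fin (k + 1)) ℂ) m with hH
  obtain ⟨B, hB⟩ := prod_sub_pow_eq_sum m k fun i => (X - C (MvPolynomial.X i : MvPolynomial (Fin (k + 1)) ℂ) : (MvPolynomial (Fin (k + 1)) ℂ)[X])
  have h1 : (∏ i : Fin (k + 1), ∏ j ∈ Finset.Ioi i, ((X - C (MvPolynomial.X j : MvPolynomial (Fin (k + 1)) ℂ) : (MvPolynomial (Fin (k + 1)) ℂ)[X]) -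
      (X - C (MvPolynomial.X i : MvPolynomial (Fin (k + 1)) ℂ) : (MvPolynomial (Fin (k + 1)) ℂ)[X]))) ^ (2 * m) = C (vdm (k + 1) ^ (2 * m)) := by
    rw [vdm, ← Finset.prod_pow, ← Finset.prod_pow, map_prod]
    refine Finset.prod_congr rfl fun i _ => ?_
    rw [← Finset.prod_pow, ← Finset.prod_pow, map_prod]
    refine Finset.prod_congr rfl fun j _ => ?_
    rw [sub_sub_sub_cancel_left, ← C_sub, ← C_pow, pow_mul, pow_mul, sub_sq_comm]
  rw [h1] at hB
  -- A common bound e lets all summands be reversed in the same degree e + mk.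
  obtain ⟨e, he⟩ : ∃ e, ∀ i, (B i).natDegree ≤ e :=
    ⟨Finset.univ.sup fun i => (B i).natDegree, fun i =>
      Finset.le_sup (f := fun i => (B i).natDegree) (Finset.mem_univ i)⟩
  have h2 : ∀ i, (B i * ∏ j ∈ Finset.univ.erase i, (X - C (MvPolynomial.X j : MvPolynomial (Fin (k + 1)) ℂ)) ^ m).reflect
      (e + m * k) = (B i).reflect e *
        ∏ j ∈ Finset.univ.erase i, (1 - C (MvPolynomial.X j : MvPolynomial (Fin (k + 1)) ℂ) * X) ^ m := by
    intro i
    have h3 := reflect_prod_X_sub_C_pow (fun j => (MvPolynomial.X j : MvPolynomial (Fin (k + 1)) ℂ)) m (Finset.univ.erase i)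
    have h4 : (Finset.univ.erase i).card = k := by simp
    rw [h4] at h3
    rw [reflect_mul _ _ (he i) h3.1, h3.2]
  have h3 : PowerSeries.coeff (e + m * k + r)
      (((C (vdm (k + 1) ^ (2 * m))).reflect (e + m * k) : (MvPolynomial (Fin (k + 1)) ℂ)[X]) * H : PowerSeries (MvPolynomial (Fin (k + 1)) ℂ)) =
      vdm (k + 1) ^ (2 * m) * PowerSeries.coeff r H := by
    rw [reflect_C, Polynomial.coe_mul, Polynomial.coe_C, Polynomial.coe_pow, Polynomial.coe_X,
      mul_assoc, PowerSeries.coeff_C_mul, add_comm _ r, PowerSeries.coeff_X_pow_mul]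
  have h4 : ∀ s : Finset (Fin (k + 1)), ∀ f : Fin (k + 1) → (MvPolynomial (Fin (k + 1)) ℂ)[X], ∀ N,
      (∑ i ∈ s, f i).reflect N = ∑ i ∈ s, (f i).reflect N := by
    intro s f N
    ext j
    simp only [coeff_reflect, finsetSum_coeff]
  rw [← h3, hB, h4]
  simp only [h2]
  have h5 : ((∑ i, (B i).reflect e * ∏ j ∈ Finset.univ.erase i,
      (1 - C (MvPolynomial.X j : MvPolynomial (Fin (k + 1)) ℂ) * X) ^ m : (MvPolynomial (Fin (k + 1)) ℂ)[X]) : PowerSeries (MvPolynomial (Fin (k + 1)) ℂ)) * H =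
      ∑ i, ((B i).reflect e : PowerSeries (MvPolynomial (Fin (k + 1)) ℂ)) * oneSubInvPow (MvPolynomial.X i : MvPolynomial (Fin (k + 1)) ℂ) m := by
    rw [← Polynomial.coeToPowerSeries.ringHom_apply, map_sum, Finset.sum_mul]
    refine Finset.sum_congr rfl fun i _ => ?_
    rw [map_mul, map_prod, mul_assoc]
    congr 1
    rw [hH, ← Finset.mul_prod_erase _ _ (Finset.mem_univ i), mul_left_comm,
      ← Finset.prod_mul_distrib, Finset.prod_eq_one, mul_one]
    intro j _
    rw [map_pow, Polynomial.coeToPowerSeries.ringHom_apply, coe_one_sub_C_mul_X,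
      oneSub_pow_mul_inv]
  rw [h5, map_sum]
  refine sum_mem fun i _ => ?_
  rw [PowerSeries.coeff_mul]
  refine sum_mem fun uv huv => ?_
  rw [Finset.HasAntidiagonal.mem_antidiagonal] at huv
  -- The reversed B_i has degree at most e, so out of the total e + mk + r at least mk + r ≥ n is
  -- left as the exponent of z_i.
  by_cases hu : uv.1 ≤ e
  · refine Ideal.mul_mem_left _ _ ?_
    rw [oneSubInvPow, PowerSeries.coeff_rescale]
    refine Ideal.mul_mem_right _ _ ?_
    have h6 : (MvPolynomial.X i : MvPolynomial (Fin (k + 1)) ℂ) ^ uv.2 = MvPolynomial.X i ^ (uv.2 - n) *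
        MvPolynomial.X i ^ n := by
      rw [← pow_add]
      congr 1
      omega
    rw [h6]
    exact Ideal.mul_mem_left _ _ (Ideal.subset_span ⟨i, rfl⟩)
  · rw [Polynomial.coeff_coe, coeff_reflect, revAt_eq_self_of_lt (by omega),
      coeff_eq_zero_of_natDegree_lt (by have := he i; omega), zero_mul]
    exact zero_mem _

/-- The exponent is -m because √(2m) · √(2m)/2 = m. This explains the half in the evaluation: the
full value √(2m) would give the exponent -2m. -/
theorem powerSums_creationCoeff (m k : ℕ) (j : ℤ) :
    powerSums (sqrtTwo m / 2) k (creationCoeff m j) =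
      intCoeff (∏ i : Fin k, oneSubInvPow (MvPolynomial.X i : MvPolynomial (Fin k) ℂ) m) j := by
  have h : PowerSeries.map (powerSums (sqrtTwo m / 2) k : Fock →+* MvPolynomial (Fin k) ℂ)
      (creation m) = ∏ i : Fin k, oneSubInvPow (MvPolynomial.X i : MvPolynomial (Fin k) ℂ) m := by
    refine map_creation_eq _ m _ _ (HasLogDeriv.prod _ _ _ fun i _ =>
      ((hasLogDeriv_oneSub _).pow m).neg_of_mul_eq_one (oneSub_pow_mul_inv _ m)) ?_ ?_
    · rw [PowerSeries.coeff_zero_eq_constantCoeff_apply, map_prod]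
      refine Finset.prod_eq_one fun i _ => ?_
      rw [← PowerSeries.coeff_zero_eq_constantCoeff_apply, coeff_zero_oneSubInvPow]
    · intro i
      change _ = powerSums (sqrtTwo m / 2) k (MvPolynomial.C (sqrtTwo m)) *
        powerSums (sqrtTwo m / 2) k (MvPolynomial.X i.succPNat)
      have hc : sqrtTwo m * (sqrtTwo m / 2) = m := by
        rw [← mul_div_assoc, ← pow_two, sqrtTwo_sq]
        ring
      rw [MvPolynomial.algHom_C, MvPolynomial.algebraMap_eq, powerSums_X, ← mul_assoc,
        ← MvPolynomial.C_mul, hc, MvPolynomial.psum, Finset.mul_sum, map_sum]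
      refine Finset.sum_congr rfl fun j _ => ?_
      rw [mul_neg, neg_neg, ← nsmul_eq_mul, map_nsmul, geomSeries, PowerSeries.coeff_mk,
        nsmul_eq_mul, map_natCast]
      rfl
  rw [creationCoeff_eq_intCoeff, ← h]
  exact map_intCoeff (powerSums (sqrtTwo m / 2) k : Fock →+* MvPolynomial (Fin k) ℂ) _ _

theorem coeff_prod_mem {R A ι : Type*} [CommRing R] [CommRing A] [Algebra R A]
    (S : Subalgebra R A) (s : Finset ι) (f : ι → PowerSeries A)
    (h : ∀ i ∈ s, ∀ n, PowerSeries.coeff n (f i) ∈ S) (n : ℕ) :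
    PowerSeries.coeff n (∏ i ∈ s, f i) ∈ S := by
  classical
  rw [PowerSeries.coeff_prod]
  exact sum_mem fun l _ => prod_mem fun i hi => h i hi _

theorem conv_mem {R : Type*} [CommRing R] [Algebra ℂ R] {k : ℕ} (S : Subalgebra ℂ R) (e : ℤ → R)
    (he : ∀ j, e j ∈ S) (a : Fin k → ℤ) (Q : MvPolynomial (Fin k) ℂ) : conv e a Q ∈ S := by
  rw [conv_eq_sum]
  exact sum_mem fun c _ => S.smul_mem (prod_mem fun i _ => he _) _

/-- A factor z_i^n pushes the index a_i < n below zero. -/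
theorem conv_eq_zero_of_mem_span {R : Type*} [CommRing R] [Algebra ℂ R] {k n : ℕ} (e : ℤ → R)
    (he : ∀ j < 0, e j = 0) (a : Fin k → ℤ) (ha : ∀ i, a i < n) (Q : MvPolynomial (Fin k) ℂ)
    (hQ : Q ∈ Ideal.span (Set.range fun i : Fin k =>
        (MvPolynomial.X i : MvPolynomial (Fin k) ℂ) ^ n)) : conv e a Q = 0 := by
  obtain ⟨B, hB⟩ := Ideal.mem_span_range_iff_exists_fun.1 hQ
  rw [← hB, map_sum]
  refine Finset.sum_eq_zero fun i _ => ?_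
  rw [mul_comm, MvPolynomial.X_pow_eq_monomial, conv_monomial_mul, one_smul, conv_eq_sum]
  refine Finset.sum_eq_zero fun c _ => ?_
  rw [Finset.prod_eq_zero (Finset.mem_univ i), smul_zero]
  apply he
  have := ha i
  rw [Finsupp.single_eq_same]
  omega

theorem coeff_X_pow_mul_of_supported {k : ℕ} (i : Fin k) (s : ℕ) (w : MvPolynomial (Fin k) ℂ)
    (hw : w ∈ MvPolynomial.supported ℂ ({i}ᶜ : Set (Fin k))) (c : Fin k →₀ ℕ) (h : s ≠ c i) :
    (MvPolynomial.X i ^ s * w).coeff c = 0 := by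
  rw [MvPolynomial.X_pow_eq_monomial, MvPolynomial.coeff_monomial_mul']
  split_ifs with hle
  · rw [one_mul]
    by_contra h0
    rw [MvPolynomial.mem_supported] at hw
    have h1 : i ∈ w.vars := by
      rw [MvPolynomial.mem_vars_iff_mem_support]
      refine ⟨_, MvPolynomial.mem_support_iff.2 h0, ?_⟩
      have := hle i
      rw [Finsupp.single_eq_same] at this
      rw [Finsupp.mem_support_iff, Finsupp.tsub_apply, Finsupp.single_eq_same]
      omega
    exact hw h1 rfl
  · rfl

theorem coeff_prod_oneSubInvPow (m k r : ℕ) (L : ℕ) (hL : r < L) :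
    PowerSeries.coeff r (∏ i : Fin k, oneSubInvPow (MvPolynomial.X i : MvPolynomial (Fin k) ℂ)
      (m + 1)) = ∑ l ∈ (Fintype.piFinset fun _ : Fin k => Finset.range L) with ∑ i, l i = r,
        MvPolynomial.monomial (Finsupp.equivFunOnFinite.symm l)
          (∏ i, ((m + l i).choose m : ℂ)) := by
  rw [PowerSeries.coeff_prod]
  refine Finset.sum_nbij' (fun l => (l : Fin k → ℕ)) (fun l => Finsupp.equivFunOnFinite.symm l)
    ?_ ?_ ?_ ?_ ?_
  · intro l hl
    rw [Finset.mem_finsuppAntidiag] at hl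
    rw [Finset.mem_filter, Fintype.mem_piFinset]
    refine ⟨fun i => Finset.mem_range.2 ?_, hl.1⟩
    have := Finset.single_le_sum (f := fun i => l i) (fun _ _ => Nat.zero_le _) (Finset.mem_univ i)
    have h2 : ∑ i, l i = r := hl.1
    omega
  · intro l hl
    rw [Finset.mem_filter] at hl
    rw [Finset.mem_finsuppAntidiag]
    exact ⟨hl.2, Finset.subset_univ _⟩
  · intro l _
    simp
  · intro l _
    rfl
  · intro l _
    rw [MvPolynomial.monomial_eq, Finsupp.prod_fintype _ _ (by simp), map_prod,
      ← Finset.prod_mul_distrib]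
    refine Finset.prod_congr rfl fun i _ => ?_
    rw [coeff_oneSubInvPow]
    simp

/-- Isolate the variable x_{i₀}: the part of the image of exponent r in it comes from V^{2m} times
the coefficient of T^r in ∏ (1 - z_i T)^{-m}. For r + m(k-1) ≥ n this lies in (z_1^n, …, z_k^n),
where `conv` at indices below n vanishes. -/
theorem powerSums_conv_support {m : ℕ} (hm : 1 ≤ m) {k n : ℕ} (a : Fin k → ℤ)
    (ha : ∀ i, a i < n) (c : Fin k →₀ ℕ)
    (hc : c ∈ (powerSums (sqrtTwo m / 2) k
      (conv (creationCoeff m) a (vdm k ^ (2 * m)))).support) (i₀ : Fin k) :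
    c i₀ + m * (k - 1) < n := by
  by_contra hcn
  push Not at hcn
  obtain ⟨m, rfl⟩ : ∃ m', m = m' + 1 := ⟨m - 1, by omega⟩
  obtain ⟨k, rfl⟩ : ∃ k', k = k' + 1 := ⟨k - 1, by have := i₀.pos; omega⟩
  rw [MvPolynomial.mem_support_iff] at hc
  apply hc
  obtain ⟨L, hL1, hL2⟩ : ∃ L : ℕ, c i₀ < L ∧ ∀ i, a i < L :=
    ⟨c i₀ + n + 1, by omega, fun i => by have := ha i; push_cast; omega⟩
  -- e' is the series with the factor of x_{i₀} removed, so its coefficients do not involve x_{i₀}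
  -- and the power of x_{i₀} can be read off from l alone.
  set e' : ℤ → MvPolynomial (Fin (k + 1)) ℂ := intCoeff (∏ i ∈ Finset.univ.erase i₀,
    oneSubInvPow (MvPolynomial.X i : MvPolynomial (Fin (k + 1)) ℂ) (m + 1)) with he'
  have hS : ∀ j, e' j ∈ MvPolynomial.supported ℂ ({i₀}ᶜ : Set (Fin (k + 1))) := by
    intro j
    rw [he', intCoeff]
    split_ifs
    · refine coeff_prod_mem _ _ _ (fun i hi n => ?_) _
      rw [coeff_oneSubInvPow]
      refine mul_mem (natCast_mem _ _) (pow_mem ?_ _)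
      rw [MvPolynomial.X_mem_supported]
      exact Finset.ne_of_mem_erase hi
    · exact zero_mem _
  rw [map_conv, conv_expand _ e' (fun l => MvPolynomial.C ((m + l).choose m : ℂ) *
    MvPolynomial.X i₀ ^ l) L ?_ a hL2, MvPolynomial.coeff_sum,
    ← Finset.sum_filter_add_sum_filter_not _ (fun l => ∑ i, l i = c i₀)]
  · refine (congrArg₂ (· + ·) ?_ (Finset.sum_eq_zero ?_)).trans (add_zero 0)
    · rw [← MvPolynomial.coeff_sum]
      have h1 : ∑ l ∈ (Fintype.piFinset fun _ : Fin (k + 1) => Finset.range L) with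
          ∑ i, l i = c i₀, (∏ i, (MvPolynomial.C ((m + l i).choose m : ℂ) *
            MvPolynomial.X i₀ ^ l i)) * conv e' (fun i => a i - l i) (vdm (k + 1) ^ (2 * (m + 1))) =
          MvPolynomial.X i₀ ^ c i₀ * conv e' a (PowerSeries.coeff (c i₀) (∏ i : Fin (k + 1),
            oneSubInvPow (MvPolynomial.X i : MvPolynomial (Fin (k + 1)) ℂ) (m + 1)) *
              vdm (k + 1) ^ (2 * (m + 1))) := by
        rw [coeff_prod_oneSubInvPow m (k + 1) (c i₀) L hL1, Finset.sum_mul, map_sum, Finset.mul_sum]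
        refine Finset.sum_congr rfl fun l hl => ?_
        rw [Finset.mem_filter] at hl
        rw [conv_monomial_mul, Finset.prod_mul_distrib, Finset.prod_pow_eq_pow_sum, hl.2,
          MvPolynomial.smul_eq_C_mul, map_prod]
        simp only [Finsupp.equivFunOnFinite_symm_apply_apply]
        ring
      rw [h1, mul_comm (PowerSeries.coeff _ _), conv_eq_zero_of_mem_span e' ?_ a ha _
        (vdm_pow_mul_coeff_mem (m + 1) k n (c i₀) (by simpa using hcn))]
      · simp
      · intro j hj
        exact intCoeff_of_neg _ hj
    · intro l hl
      rw [Finset.mem_filter] at hl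
      rw [Finset.prod_mul_distrib, Finset.prod_pow_eq_pow_sum, mul_assoc, mul_left_comm]
      refine coeff_X_pow_mul_of_supported _ _ _ ?_ _ hl.2
      refine mul_mem (prod_mem fun i _ => ?_) (conv_mem _ _ hS _ _)
      exact Subalgebra.algebraMap_mem _ _
  · intro j hj
    change powerSums _ _ (creationCoeff _ _) = _
    rw [powerSums_creationCoeff, ← Finset.mul_prod_erase _ _ (Finset.mem_univ i₀),
      intCoeff_mul _ _ _ L hj]
    refine Finset.sum_congr rfl fun l _ => ?_
    rw [coeff_oneSubInvPow, map_natCast]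

/-! ### Symmetric polynomials with bounded exponents -/

/-- Symmetric polynomials in `k` variables, homogeneous of degree `d`, with all exponents below
`N`. -/
def symBox (k N d : ℕ) : Submodule ℂ (MvPolynomial (Fin k) ℂ) where
  carrier := {P | P.IsSymmetric ∧ P.IsHomogeneous d ∧ ∀ c ∈ P.support, ∀ i, c i < N}
  add_mem' := by
    classical
    rintro P Q ⟨h1, h2, h3⟩ ⟨h1', h2', h3'⟩
    refine ⟨h1.add h1', h2.add h2', fun c hc => ?_⟩
    rcases Finset.mem_union.1 (MvPolynomial.support_add hc) with h | h
    · exact h3 c h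
    · exact h3' c h
  zero_mem' := ⟨MvPolynomial.IsSymmetric.zero, MvPolynomial.isHomogeneous_zero _ _ _, by simp⟩
  smul_mem' := by
    rintro x P ⟨h1, h2, h3⟩
    refine ⟨h1.smul x, ?_, fun c hc => h3 c (MvPolynomial.support_smul hc)⟩
    rw [MvPolynomial.smul_eq_C_mul]
    exact h2.C_mul x

/-- Partitions of `d` into `k` parts (zero allowed) below `N`, in increasing order. -/
def boxSet (k N d : ℕ) : Finset (Fin k → ℕ) :=
  {f ∈ Fintype.piFinset fun _ => Finset.range N | (∀ i j, i ≤ j → f i ≤ f j) ∧ ∑ i, f i = d}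

theorem mem_boxSet {k N d : ℕ} {f : Fin k → ℕ} :
    f ∈ boxSet k N d ↔ (∀ i, f i < N) ∧ Monotone f ∧ ∑ i, f i = d := by
  simp [boxSet, Fintype.mem_piFinset, Monotone]

/-- The exponent vector of a function. -/
abbrev expo {k : ℕ} (f : Fin k → ℕ) : Fin k →₀ ℕ := Finsupp.equivFunOnFinite.symm f

theorem coeff_comp_perm {k : ℕ} {P : MvPolynomial (Fin k) ℂ} (hP : P.IsSymmetric) (f : Fin k → ℕ)
    (σ : Equiv.Perm (Fin k)) : P.coeff (expo (f ∘ σ)) = P.coeff (expo f) := by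
  conv_lhs => rw [← hP σ.symm]
  rw [← MvPolynomial.coeff_rename_mapDomain σ.symm σ.symm.injective P (expo f)]
  congr 1
  ext i
  rw [← Finsupp.equivMapDomain_eq_mapDomain]
  simp

/-- The coefficients of a symmetric polynomial at increasing exponents. -/
def boxCoeff (k N d : ℕ) : symBox k N d →ₗ[ℂ] (boxSet k N d → ℂ) where
  toFun P f := P.1.coeff (expo f.1)
  map_add' P Q := by ext f; simp
  map_smul' x P := by ext f; simp

theorem boxCoeff_injective (k N d : ℕ) : Function.Injective (boxCoeff k N d) := by
  rw [← LinearMap.ker_eq_bot, LinearMap.ker_eq_bot']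
  rintro ⟨P, h1, h2, h3⟩ h
  ext c
  by_contra hc
  have hc' : c ∈ P.support := MvPolynomial.mem_support_iff.2 hc
  -- Symmetry allows an exponent to be sorted, so a nonzero coefficient would also occur at an
  -- increasing exponent.
  have h4 : (c : Fin k → ℕ) ∘ Tuple.sort (c : Fin k → ℕ) ∈ boxSet k N d := by
    rw [mem_boxSet]
    refine ⟨fun i => h3 c hc' _, Tuple.monotone_sort _, ?_⟩
    rw [← h2 hc, Finsupp.weight_apply, Finsupp.sum_fintype _ _ (by simp)]
    simp only [Function.comp_apply, Pi.one_apply, smul_eq_mul, mul_one]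
    exact Equiv.sum_comp (Tuple.sort (c : Fin k → ℕ)) (c : Fin k → ℕ)
  have h5 := congrFun h ⟨_, h4⟩
  have h6 : boxCoeff k N d ⟨P, h1, h2, h3⟩ ⟨_, h4⟩ = P.coeff (expo (c : Fin k → ℕ)) :=
    coeff_comp_perm h1 _ _
  rw [h6] at h5
  apply hc
  have h7 : expo (c : Fin k → ℕ) = c := by ext i; rfl
  rw [← h7]
  exact h5

theorem boxCoeff_surjective (k N d : ℕ) : Function.Surjective (boxCoeff k N d) := by
  rw [← LinearMap.range_eq_top, eq_top_iff, ← (Pi.basisFun ℂ (boxSet k N d)).span_eq,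
    Submodule.span_le]
  rintro _ ⟨f, rfl⟩
  obtain ⟨f, hf⟩ := f
  have hf' := mem_boxSet.1 hf
  set P : MvPolynomial (Fin k) ℂ := ∑ σ : Equiv.Perm (Fin k),
    MvPolynomial.rename σ (MvPolynomial.monomial (expo f) 1) with hP
  have hmon : ∀ σ : Equiv.Perm (Fin k), MvPolynomial.rename σ (MvPolynomial.monomial (expo f) 1) =
      (MvPolynomial.monomial (expo (f ∘ σ.symm)) 1 : MvPolynomial (Fin k) ℂ) := by
    intro σ
    rw [MvPolynomial.rename_monomial]
    congr 2
    ext i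
    rw [← Finsupp.equivMapDomain_eq_mapDomain]
    simp
  have hcoeff : ∀ c, P.coeff c = ∑ σ : Equiv.Perm (Fin k),
      if expo (f ∘ σ.symm) = c then (1 : ℂ) else 0 := by
    intro c
    rw [hP, MvPolynomial.coeff_sum]
    refine Finset.sum_congr rfl fun σ _ => ?_
    rw [hmon, MvPolynomial.coeff_monomial]
  have hmem : P ∈ symBox k N d := by
    refine ⟨fun e => ?_, MvPolynomial.IsHomogeneous.sum _ _ _ fun σ _ => ?_, fun c hc i => ?_⟩
    · rw [hP, map_sum]
      refine Fintype.sum_equiv (Equiv.mulLeft e) _ _ fun σ => ?_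
      rw [MvPolynomial.rename_rename]
      rfl
    · refine MvPolynomial.IsHomogeneous.rename_isHomogeneous
        (MvPolynomial.isHomogeneous_monomial _ ?_)
      rw [← hf'.2.2, Finsupp.degree_eq_sum]
      rfl
    · rw [MvPolynomial.mem_support_iff, hcoeff] at hc
      obtain ⟨σ, _, hσ⟩ := Finset.exists_ne_zero_of_sum_ne_zero hc
      rw [ne_eq, ite_eq_right_iff, Classical.not_imp] at hσ
      rw [← hσ.1]
      exact hf'.1 _
  -- The sum runs over all permutations, so this coefficient is the order of the stabilizer of f,
  -- which contains the identity. It is divided out at the end.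
  have hne : P.coeff (expo f) ≠ 0 := by
    rw [hcoeff, Finset.sum_boole, Nat.cast_ne_zero]
    exact Finset.card_ne_zero_of_mem (a := 1) (by simp [← Equiv.Perm.inv_def])
  have h0 : ∀ g ∈ boxSet k N d, g ≠ f → P.coeff (expo g) = 0 := by
    intro g hg hgf
    rw [hcoeff]
    refine Finset.sum_eq_zero fun σ _ => if_neg fun h => hgf ?_
    have h1 : f ∘ σ.symm = g := Finsupp.equivFunOnFinite.symm.injective h
    rw [← h1]
    exact Tuple.unique_monotone (σ := σ.symm) (τ := 1)
      (by rw [h1]; exact (mem_boxSet.1 hg).2.1) hf'.2.1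
  refine ⟨(P.coeff (expo f))⁻¹ • ⟨P, hmem⟩, ?_⟩
  rw [map_smul]
  ext g
  rw [Pi.basisFun_apply, Pi.smul_apply, smul_eq_mul]
  change _ * P.coeff (expo g.1) = _
  by_cases hg : g = ⟨f, hf⟩
  · subst hg
    rw [Pi.single_eq_same, inv_mul_cancel₀ hne]
  · rw [Pi.single_eq_of_ne hg, h0 g.1 g.2 fun h => hg (Subtype.ext h), mul_zero]

/-- Symmetric polynomials in a box, by their coefficients. -/
def boxEquiv (k N d : ℕ) : symBox k N d ≃ₗ[ℂ] (boxSet k N d → ℂ) :=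
  LinearEquiv.ofBijective (boxCoeff k N d) ⟨boxCoeff_injective k N d, boxCoeff_surjective k N d⟩

instance (k N d : ℕ) : Module.Finite ℂ (symBox k N d) :=
  Module.Finite.equiv (boxEquiv k N d).symm

theorem finrank_symBox (k N d : ℕ) : Module.finrank ℂ (symBox k N d) = (boxSet k N d).card := by
  rw [(boxEquiv k N d).finrank_eq, Module.finrank_fintype_fun_eq_card, Fintype.card_coe]

/-! ### Counting partitions in a box -/

/-- The generating polynomial of the partitions with `k` parts below `N`. -/
def boxPoly : ℕ → ℕ → ℤ[X]
  | 0, _ => 1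
  | _ + 1, 0 => 0
  | k + 1, N + 1 => boxPoly k (N + 1) + X ^ (k + 1) * boxPoly (k + 1) N

/-- The recursion splits the partitions by their smallest part: if it is 0, drop it; otherwise
subtract 1 from each of the k + 1 parts. -/
theorem coeff_boxPoly (k N d : ℕ) : (boxPoly k N).coeff d = (boxSet k N d).card := by
  induction k generalizing N d with
  | zero =>
    rw [boxPoly, coeff_one]
    split_ifs with h
    · subst h
      have : boxSet 0 N 0 = {Fin.elim0} := by
        ext f
        simp only [mem_boxSet, Finset.mem_singleton, Subsingleton.elim f Fin.elim0]
        simp [Subsingleton.monotone]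
      rw [this]
      simp
    · have : boxSet 0 N d = ∅ := by
        ext f
        simp [mem_boxSet, Ne.symm h]
      rw [this]
      simp
  | succ k ih =>
    induction N generalizing d with
    | zero =>
      have : boxSet (k + 1) 0 d = ∅ := by
        ext f
        simp [mem_boxSet]
      rw [this, boxPoly]
      simp
    | succ N ihN =>
      rw [boxPoly, coeff_add, ih, coeff_X_pow_mul']
      have h1 : ((boxSet (k + 1) (N + 1) d).filter fun f => f 0 = 0).card =
          (boxSet k (N + 1) d).card := by
        refine Finset.card_nbij' (fun f => Fin.tail f) (fun f => Fin.cons 0 f) ?_ ?_ ?_ ?_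
        · intro f hf
          simp only [Finset.coe_filter, Set.mem_ofPred_eq, Finset.mem_coe, mem_boxSet] at hf ⊢
          obtain ⟨⟨hf1, hf2, hf3⟩, hf4⟩ := hf
          refine ⟨fun i => hf1 _, fun i j hij => hf2 (Fin.succ_le_succ_iff.2 hij), ?_⟩
          rw [Fin.sum_univ_succ, hf4, zero_add] at hf3
          exact hf3
        · intro f hf
          simp only [Finset.coe_filter, Set.mem_ofPred_eq, Finset.mem_coe, mem_boxSet] at hf ⊢
          obtain ⟨hf1, hf2, hf3⟩ := hf
          refine ⟨⟨fun i => ?_, fun i j hij => ?_, ?_⟩, rfl⟩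
          · cases i using Fin.cases with
            | zero => simp
            | succ i => simpa using hf1 i
          · cases i using Fin.cases with
            | zero => simp
            | succ i =>
              cases j using Fin.cases with
              | zero => exact absurd hij (by simp [Fin.succ_ne_zero])
              | succ j => simpa using hf2 (Fin.succ_le_succ_iff.1 hij)
          · rw [Fin.sum_univ_succ]
            simpa using hf3
        · intro f hf
          simp only [Finset.coe_filter, Set.mem_ofPred_eq] at hf
          have h := Fin.cons_self_tail f
          rw [hf.2] at h
          exact h
        · intro f _
          exact Fin.tail_cons _ _
      have hpos : ∀ f : Fin (k + 1) → ℕ, Monotone f → f 0 ≠ 0 → ∀ i, 1 ≤ f i := fun f hf h0 i =>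
        (Nat.one_le_iff_ne_zero.2 h0).trans (hf (Fin.zero_le i))
      have h2 : ((boxSet (k + 1) (N + 1) d).filter fun f => ¬ f 0 = 0).card =
          if k + 1 ≤ d then (boxSet (k + 1) N (d - (k + 1))).card else 0 := by
        split_ifs with hd
        · refine Finset.card_nbij' (fun f i => f i - 1) (fun f i => f i + 1) ?_ ?_ ?_ ?_
          · intro f hf
            simp only [Finset.coe_filter, Set.mem_ofPred_eq, Finset.mem_coe, mem_boxSet] at hf ⊢
            obtain ⟨⟨hf1, hf2, hf3⟩, hf4⟩ := hf
            have hpos := hpos f hf2 hf4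
            refine ⟨fun i => ?_, fun i j hij => Nat.sub_le_sub_right (hf2 hij) 1, ?_⟩
            · have := hf1 i
              have := hpos i
              omega
            · rw [Finset.sum_tsub_distrib _ fun i _ => hpos i, hf3]
              simp
          · intro f hf
            simp only [Finset.coe_filter, Set.mem_ofPred_eq, Finset.mem_coe, mem_boxSet] at hf ⊢
            obtain ⟨hf1, hf2, hf3⟩ := hf
            refine ⟨⟨fun i => Nat.succ_lt_succ (hf1 i), fun i j hij => Nat.succ_le_succ (hf2 hij),
              ?_⟩, Nat.succ_ne_zero _⟩
            rw [Finset.sum_add_distrib, hf3]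
            simp
            omega
          · intro f hf
            simp only [Finset.coe_filter, Set.mem_ofPred_eq, mem_boxSet] at hf
            ext i
            exact Nat.sub_add_cancel (hpos f hf.1.2.1 hf.2 i)
          · intro f _
            ext i
            simp
        · rw [Finset.card_eq_zero, Finset.filter_eq_empty_iff]
          intro f hf hf4
          obtain ⟨hf1, hf2, hf3⟩ := mem_boxSet.1 hf
          have h3 := Finset.sum_le_sum fun i (_ : i ∈ Finset.univ) => hpos f hf2 hf4 i
          rw [hf3] at h3
          simp at h3
          omega
      rw [← Finset.card_filter_add_card_filter_not (s := boxSet (k + 1) (N + 1) d)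
        (fun f => f 0 = 0), h1, h2]
      push_cast
      congr 1
      split_ifs
      · exact ihN _
      · rfl

theorem gaussNat_self_succ (k : ℕ) : ∀ j, k < j → gaussNat k j = 0 := by
  induction k with
  | zero => intro j hj; obtain ⟨j, rfl⟩ : ∃ j', j = j' + 1 := ⟨j - 1, by omega⟩; rfl
  | succ k ih =>
    intro j hj
    obtain ⟨j, rfl⟩ : ∃ j', j = j' + 1 := ⟨j - 1, by omega⟩
    rw [gaussNat, ih j (by omega), ih (j + 1) (by omega)]
    simp

theorem boxPoly_succ (k N : ℕ) : boxPoly k (N + 1) = gaussNat (N + k) k := by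
  induction k generalizing N with
  | zero =>
    rw [boxPoly]
    cases N <;> simp [gaussNat]
  | succ k ih =>
    induction N with
    | zero =>
      rw [boxPoly, ih, ← add_assoc, gaussNat, zero_add, gaussNat_self_succ k (k + 1) (by omega),
        boxPoly]
    | succ N ihN =>
      have h1 : N + 1 + (k + 1) = (N + 1 + k) + 1 := by ring
      have h2 : N + (k + 1) = N + 1 + k := by ring
      rw [boxPoly, ih, ihN, h1, gaussNat, h2]

/-! ### Dimensions of the homogeneous parts -/

/-- The degree `d` part of the span of products of `k` modes applied to the extremal vector. -/
def fockPart (m n k d : ℕ) : Submodule ℂ Fock :=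
  Submodule.span ℂ {u | ∃ a : Fin k → ℕ, (∀ i, a i < n) ∧ ∑ i, a i = k.choose 2 * (2 * m) + d ∧
    u = conv (creationCoeff m) (fun i => (a i : ℤ)) (vdm k ^ (2 * m))}

theorem fockPart_le_creationSpan (m n k d : ℕ) : fockPart m n k d ≤ creationSpan m k := by
  rw [fockPart, Submodule.span_le]
  rintro _ ⟨a, _, _, rfl⟩
  exact conv_mem_creationSpan m _ _

theorem powerSums_mem_symBox {m : ℕ} (hm : 1 ≤ m) {n k d : ℕ} {u : Fock}
    (hu : u ∈ fockPart m n k d) :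
    powerSums (sqrtTwo m / 2) k u ∈ symBox k (n - m * (k - 1)) d := by
  have h : fockPart m n k d ≤ (symBox k (n - m * (k - 1)) d).comap
      (powerSums (sqrtTwo m / 2) k).toLinearMap := by
    rw [fockPart, Submodule.span_le]
    rintro _ ⟨a, ha, hs, rfl⟩
    refine ⟨isSymmetric_powerSums _ _ _, isHomogeneous_powerSums _ _ _ _
      (isWeightedHomogeneous_conv m _ (isHomogeneous_vdm_pow k (2 * m)) ?_), fun c hc i => ?_⟩
    · exact_mod_cast hs
    · have := powerSums_conv_support hm (fun i => (a i : ℤ)) (fun i => by exact_mod_cast ha i) c hc i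
      omega
  exact h hu

/-- Evaluation at power sums embeds the homogeneous parts into the symmetric polynomials. -/
def fockPartToBox {m : ℕ} (hm : 1 ≤ m) (n k d : ℕ) :
    fockPart m n k d →ₗ[ℂ] symBox k (n - m * (k - 1)) d :=
  (powerSums (sqrtTwo m / 2) k).toLinearMap.restrict fun _ hu => powerSums_mem_symBox hm hu

theorem fockPartToBox_injective {m : ℕ} (hm : 1 ≤ m) (n k d : ℕ) :
    Function.Injective (fockPartToBox hm n k d) := by
  rw [← LinearMap.ker_eq_bot, LinearMap.ker_eq_bot']
  rintro ⟨u, hu⟩ h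
  exact Subtype.ext (eq_zero_of_powerSums_eq_zero (fockPart_le_creationSpan m n k d hu)
    (congrArg Subtype.val h))

theorem finite_fockPart {m : ℕ} (hm : 1 ≤ m) (n k d : ℕ) : Module.Finite ℂ (fockPart m n k d) :=
  Module.Finite.of_injective _ (fockPartToBox_injective hm n k d)

/-- Preimages are chosen on a basis to make the lift linear. -/
theorem exists_lift_powerSums {m : ℕ} (hm : 1 ≤ m) (k N d : ℕ) :
    ∃ s : symBox k N d →ₗ[ℂ] Fock, ∀ τ, powerSums (sqrtTwo m) k (s τ) = τ.1 := by
  let b := Module.finBasis ℂ (symBox k N d)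
  choose F hF using fun i => mem_range_powerSums (sqrtTwo_ne_zero hm) k (b i).1 (b i).2.1
  refine ⟨b.constr ℂ F, fun τ => ?_⟩
  have h : (powerSums (sqrtTwo m) k).toLinearMap ∘ₗ b.constr ℂ F = (symBox k N d).subtype := by
    refine b.ext fun i => ?_
    rw [LinearMap.comp_apply, Module.Basis.constr_basis]
    exact hF i
  exact DFunLike.congr_fun h τ

/-- Pairing with a lift embeds the symmetric polynomials in the dual of `fockPart`. The functional
of τ takes the coefficients of V^{2m} τ as its values on the generators, so nondegeneracy gives
injectivity. -/
theorem finrank_fockPart_ge {m : ℕ} (hm : 1 ≤ m) (n k d : ℕ) :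
    Module.finrank ℂ (symBox k (n - m * (k - 1)) d) ≤ Module.finrank ℂ (fockPart m n k d) := by
  have := finite_fockPart hm n k d
  obtain ⟨s, hs⟩ := exists_lift_powerSums hm k (n - m * (k - 1)) d
  have hT : ∃ T : symBox k (n - m * (k - 1)) d →ₗ[ℂ] Module.Dual ℂ (fockPart m n k d),
      ∀ τ u, T τ u = fockPair (s τ) u.1 :=
    ⟨(Submodule.dualRestrict (fockPart m n k d)) ∘ₗ fockPair ∘ₗ s, fun _ _ => rfl⟩
  obtain ⟨T, hTa⟩ := hT
  have hT : Function.Injective T := by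
    rw [← LinearMap.ker_eq_bot, LinearMap.ker_eq_bot']
    intro τ hτ
    apply Subtype.ext
    refine eq_zero_of_coeff_vdm_mul (m := m) (n := n) τ.1 (fun c hc i => ?_) fun a ha => ?_
    · have := τ.2.2.2 c hc i
      omega
    · by_cases hsum : ∑ i, a i = k.choose 2 * (2 * m) + d
      · have hu : conv (creationCoeff m) (fun i => (a i : ℤ)) (vdm k ^ (2 * m)) ∈
            fockPart m n k d := Submodule.subset_span ⟨fun i => a i, ha, hsum, rfl⟩
        have h3 := hTa τ ⟨_, hu⟩
        rw [hτ, LinearMap.zero_apply, fockPair_conv, hs, conv_kron] at h3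
        exact h3.symm
      -- Exponents of any other total degree carry no coefficient, since V^{2m} τ is homogeneous.
      · by_contra hne
        apply hsum
        rw [← ((isHomogeneous_vdm_pow k (2 * m)).mul τ.2.2.1) hne, Finsupp.weight_apply,
          Finsupp.sum_fintype _ _ (by simp)]
        simp
  have h := LinearMap.finrank_le_finrank_of_injective hT
  rwa [Subspace.dual_finrank_eq] at h

theorem finrank_fockPart {m : ℕ} (hm : 1 ≤ m) (n k d : ℕ) :
    (Module.finrank ℂ (fockPart m n k d) : ℤ) = (boxPoly k (n - m * (k - 1))).coeff d := by
  rw [coeff_boxPoly, ← finrank_symBox]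
  exact_mod_cast le_antisymm
    (LinearMap.finrank_le_finrank_of_injective (fockPartToBox_injective hm n k d))
    (finrank_fockPart_ge hm n k d)

/-! ### Eigenvalues -/

theorem heis_zero_single (m : ℕ) (c : ℤ) (f : Fock) :
    heis m 0 (Finsupp.single c f) = ((c : ℂ) / sqrtTwo m) • Finsupp.single c f := by
  have h1 : heis m 0 = heis m (.ofNat 0) := rfl
  rw [h1]
  simp [heis]

theorem heis_pos_single (m k : ℕ) (c : ℤ) (f : Fock) :
    heis m ((k : ℤ) + 1) (Finsupp.single c f) =
      Finsupp.single c (((k : ℂ) + 1) • MvPolynomial.pderiv k.succPNat f) := by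
  have h1 : heis m ((k : ℤ) + 1) = heis m (.ofNat (k + 1)) := rfl
  rw [h1]
  simp only [heis, Finsupp.mapRange.linearMap_apply]
  rw [Finsupp.mapRange_single]
  rfl

theorem heis_neg_single (m k : ℕ) (c : ℤ) (f : Fock) :
    heis m (-((k : ℤ) + 1)) (Finsupp.single c f) =
      Finsupp.single c (MvPolynomial.X k.succPNat * f) := by
  have h1 : heis m (-((k : ℤ) + 1)) = heis m (.negSucc k) := by rw [Int.negSucc_eq]
  rw [h1]
  simp only [heis, Finsupp.mapRange.linearMap_apply]
  rw [Finsupp.mapRange_single]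
  rfl

theorem finsum_heis_monomial (m : ℕ) (c : ℤ) (κ : ℕ+ →₀ ℕ) (x : ℂ) :
    ∑ᶠ k : ℕ, heis m (-((k : ℤ) + 1)) (heis m ((k : ℤ) + 1)
      (Finsupp.single c (MvPolynomial.monomial κ x))) =
    (Finsupp.weight modeWeight κ : ℂ) • Finsupp.single c (MvPolynomial.monomial κ x) := by
  have h1 : ∀ k : ℕ, heis m (-((k : ℤ) + 1)) (heis m ((k : ℤ) + 1)
      (Finsupp.single c (MvPolynomial.monomial κ x))) =
      ((κ k.succPNat * (k.succPNat : ℕ) : ℕ) : ℂ) •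
        Finsupp.single c (MvPolynomial.monomial κ x) := by
    intro k
    rw [heis_pos_single, heis_neg_single, mul_smul_comm, MvPolynomial.X_mul_pderiv_monomial,
      Finsupp.smul_single, ← Nat.cast_smul_eq_nsmul ℂ, smul_smul]
    congr 2
    push_cast [Nat.succPNat_coe]
    ring
  have hinj : Function.Injective PNat.natPred := PNat.natPred_injective
  simp only [h1]
  rw [finsum_eq_sum_of_support_subset (s := κ.support.image PNat.natPred), Finset.sum_image hinj.injOn,
    ← Finset.sum_smul, Finsupp.weight_apply, Finsupp.sum]
  · simp only [PNat.succPNat_natPred, modeWeight, smul_eq_mul]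
    push_cast
    rfl
  · intro k hk
    rw [Finset.coe_image]
    refine ⟨k.succPNat, ?_, Nat.natPred_succPNat k⟩
    rw [Finset.mem_coe, Finsupp.mem_support_iff]
    intro h0
    apply hk
    simp [h0]

theorem virL0_single_monomial {m : ℕ} (hm : 1 ≤ m) (p : ℤ) (κ : ℕ+ →₀ ℕ) (x : ℂ) :
    virL0 m (Finsupp.single (-p) (MvPolynomial.monomial κ x)) =
      (degQ m p + (Finsupp.weight modeWeight κ : ℕ)) •
        Finsupp.single (-p) (MvPolynomial.monomial κ x) := by
  have hs := sqrtTwo_ne_zero hm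
  have hsq := sqrtTwo_sq m
  have hm0 : (m : ℂ) ≠ 0 := by exact_mod_cast (by omega : m ≠ 0)
  simp only [virL0, LinearMap.coe_mk, AddHom.coe_mk]
  rw [finsum_heis_monomial, heis_zero_single, map_smul, heis_zero_single]
  simp only [smul_smul, ← add_smul, ← sub_smul]
  congr 1
  have h2 : ((-p : ℤ) : ℂ) / sqrtTwo m * (((-p : ℤ) : ℂ) / sqrtTwo m) = (p : ℂ) ^ 2 / (2 * m) := by
    rw [← hsq]; push_cast; field_simp
  have h3 : ((m : ℂ) - 1) / sqrtTwo m * (((-p : ℤ) : ℂ) / sqrtTwo m) =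
      -((m : ℂ) - 1) * p / (2 * m) := by
    rw [← hsq]; push_cast; field_simp
  rw [h3, h2, degQ]
  field_simp
  ring

theorem virL0_single {m : ℕ} (hm : 1 ≤ m) (p : ℤ) (d : ℕ) (f : Fock)
    (hf : f.IsWeightedHomogeneous modeWeight d) :
    virL0 m (Finsupp.single (-p) f) = (degQ m p + d) • Finsupp.single (-p) f := by
  have h1 : Finsupp.single (-p) f = ∑ κ ∈ f.support,
      (Finsupp.single (-p) (MvPolynomial.monomial κ (f.coeff κ)) : Space) := by
    conv_lhs => rw [f.as_sum, ← Finsupp.lsingle_apply (R := ℂ), map_sum]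
    rfl
  rw [h1, map_sum, Finset.smul_sum]
  refine Finset.sum_congr rfl fun κ hκ => ?_
  rw [virL0_single_monomial hm, hf (MvPolynomial.mem_support_iff.1 hκ)]

theorem commute_heis_virL0 {m : ℕ} (hm : 1 ≤ m) : Commute (heis m 0) (virL0 m) := by
  refine LinearMap.ext fun v => ?_
  induction v using Finsupp.induction_linear with
  | zero => simp
  | add v w hv hw => rw [map_add, hv, hw, map_add]
  | single c f =>
    obtain ⟨p, rfl⟩ : ∃ p : ℤ, c = -p := ⟨-c, by simp⟩
    induction f using MvPolynomial.induction_on' with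
    | monomial κ x =>
      rw [Module.End.mul_apply, Module.End.mul_apply, virL0_single_monomial hm, heis_zero_single,
        map_smul, map_smul, virL0_single_monomial hm, heis_zero_single, smul_comm]
    | add f g hf hg => rw [Finsupp.single_add, map_add, hf, hg, map_add]

/-- The joint eigenspaces of `h₀` and `L₀`. -/
def jointEigenspace (m : ℕ) (d : ℂ × ℂ) : Submodule ℂ Space :=
  Module.End.eigenspace (heis m 0) d.1 ⊓ Module.End.eigenspace (virL0 m) d.2

/-- The two commuting operators are treated as a family over `Bool`, whose joint maximal generalized
eigenspaces are independent; the joint eigenspaces sit inside these. -/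
theorem iSupIndep_jointEigenspace {m : ℕ} (hm : 1 ≤ m) : iSupIndep (jointEigenspace m) := by
  let f : Bool → Module.End ℂ Space := fun b => cond b (heis m 0) (virL0 m)
  have hcomm : ∀ i j, Commute (f i) (f j) := by
    intro i j
    have h := commute_heis_virL0 hm
    cases i <;> cases j
    · exact Commute.refl _
    · exact h.symm
    · exact h
    · exact Commute.refl _
  have h := Module.End.independent_iInf_maxGenEigenspace_of_forall_mapsTo f fun i j φ =>
    Module.End.mapsTo_maxGenEigenspace_of_comm (hcomm j i) φ
  have hinj : Function.Injective fun (d : ℂ × ℂ) (b : Bool) => cond b d.1 d.2 := by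
    intro d d' hd
    exact Prod.ext (congrFun hd true) (congrFun hd false)
  refine (h.comp hinj).mono fun d => ?_
  refine le_iInf fun b => ?_
  cases b
  · exact inf_le_right.trans (Module.End.genEigenspace_le_maximal _ _ _)
  · exact inf_le_left.trans (Module.End.genEigenspace_le_maximal _ _ _)

/-! ### Independent families -/

section independence

variable {K M ι D : Type*} [Field K] [AddCommGroup M] [Module K M]

/-- For a vector of the sum lying in E (φ i), the component outside W i lies both in E (φ i) and in
the span of the other E's, hence vanishes. -/
theorem iSup_inf_of_iSupIndep {E : D → Submodule K M} (hE : iSupIndep E) {W : ι → Submodule K M}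
    {φ : ι → D} (hφ : Function.Injective φ) (hW : ∀ i, W i ≤ E (φ i)) (i : ι) :
    (⨆ j, W j) ⊓ E (φ i) = W i := by
  refine le_antisymm ?_ (le_inf (le_iSup W i) (hW i))
  rintro x ⟨hx, hxE⟩
  rw [SetLike.mem_coe, iSup_split_single W i] at hx
  obtain ⟨w, hw, y, hy, rfl⟩ := Submodule.mem_sup.1 hx
  have hy1 : y ∈ E (φ i) := by
    have := sub_mem hxE (hW i hw)
    rwa [add_sub_cancel_left] at this
  have hle : (⨆ (j) (_ : j ≠ i), W j) ≤ ⨆ (d) (_ : d ≠ φ i), E d :=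
    iSup₂_le fun j hj => (hW j).trans (le_iSup₂_of_le (φ j) (fun h => hj (hφ h)) le_rfl)
  have h0 := Submodule.disjoint_def.1 (hE (φ i)) y hy1 (hle hy)
  rw [h0, add_zero]
  exact hw

theorem iSup_inf_eq_bot_of_iSupIndep {E : D → Submodule K M} (hE : iSupIndep E)
    {W : ι → Submodule K M} {φ : ι → D} (hW : ∀ i, W i ≤ E (φ i)) {d : D}
    (hd : d ∉ Set.range φ) : (⨆ j, W j) ⊓ E d = ⊥ := by
  rw [inf_comm]
  refine ((hE d).mono_right ?_).eq_bot
  exact iSup_le fun j => (hW j).trans (le_iSup₂_of_le (φ j) (fun h => hd ⟨j, h⟩) le_rfl)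

theorem finrank_finset_sup {W : ι → Submodule K M} (hW : iSupIndep W)
    (hfin : ∀ i, Module.Finite K (W i)) (s : Finset ι) :
    Module.Finite K (s.sup W : Submodule K M) ∧
      Module.finrank K (s.sup W : Submodule K M) = ∑ i ∈ s, Module.finrank K (W i) := by
  classical
  induction s using Finset.induction_on with
  | empty => simp; infer_instance
  | insert a s ha ih =>
    obtain ⟨h1, h2⟩ := ih
    have := hfin a
    rw [Finset.sup_insert, Finset.sum_insert ha, ← h2]
    refine ⟨inferInstance, ?_⟩
    have h3 := Submodule.finrank_sup_add_finrank_inf_eq (W a) (s.sup W)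
    have h4 : Disjoint (W a) (s.sup W) := by
      refine (hW a).mono_right (Finset.sup_le fun i hi => ?_)
      exact le_iSup₂_of_le i (fun h => ha (h ▸ hi)) le_rfl
    rw [h4.eq_bot, finrank_bot, add_zero] at h3
    exact h3

end independence

/-! ### The decomposition of the finitized spaces -/

/-- The part of `ℂ[a_{p-1}, …, a_{p-n}] v_p` spanned by products of `k` modes, in Fock degree
`d`. -/
def gradedPart (m : ℕ) (p : ℤ) (n : ℕ) (kd : ℕ × ℕ) : Submodule ℂ Space :=
  (fockPart m n kd.1 kd.2).map (Finsupp.lsingle (-p + 2 * m * kd.1))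

/-- The algebra is spanned by words in the modes. The modes a_{p-1}, …, a_{p-n} correspond to
exponents p - 1 - j in the range from 0 to n - 1. -/
theorem finitization_eq_span (m : ℕ) (p : ℤ) (n : ℕ) :
    finitization m p n = Submodule.span ℂ {v | ∃ (k : ℕ) (a : Fin k → ℕ), (∀ i, a i < n) ∧
      v = Finsupp.single (-p + 2 * m * k)
        (conv (creationCoeff m) (fun i => (a i : ℤ)) (vdm k ^ (2 * m)))} := by
  rw [finitization, Algebra.adjoin_eq_span, Submodule.map_span]
  congr 1
  ext v
  constructor
  · rintro ⟨x, hx, rfl⟩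
    obtain ⟨l, hl, rfl⟩ := Submonoid.exists_list_of_mem_closure hx
    have h1 : ∀ i : Fin l.length, ∃ a : ℕ, a < n ∧ mode m (p - 1 - a) = l.get i := by
      intro i
      obtain ⟨j, ⟨hj1, hj2⟩, hj⟩ := hl _ (List.get_mem l i)
      refine ⟨(p - 1 - j).toNat, by omega, ?_⟩
      rw [← hj]
      congr 1
      omega
    choose a ha1 ha2 using h1
    refine ⟨l.length, a, ha1, ?_⟩
    rw [← prod_mode_extremal m p l.length fun i => (a i : ℤ)]
    simp only [ha2, List.ofFn_get]
    rfl
  · rintro ⟨k, a, ha, rfl⟩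
    refine ⟨_, Submonoid.list_prod_mem (l := List.ofFn fun i => mode m (p - 1 - a i)) _ ?_,
      prod_mode_extremal m p k fun i => (a i : ℤ)⟩
    intro x hx
    obtain ⟨i, rfl⟩ := (List.mem_ofFn' _ _).1 hx
    refine Submonoid.subset_closure ⟨_, ⟨?_, ?_⟩, rfl⟩
    · have := ha i; omega
    · omega

/-- A word whose total exponent is below the degree mk(k-1) of V^{2m} acts by zero; the excess of
the others is their Fock degree d. -/
theorem finitization_eq_iSup (m : ℕ) (p : ℤ) (n : ℕ) :
    finitization m p n = ⨆ kd, gradedPart m p n kd := by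
  rw [finitization_eq_span]
  refine le_antisymm (Submodule.span_le.2 ?_) (iSup_le fun kd => ?_)
  · rintro _ ⟨k, a, ha, rfl⟩
    rcases lt_or_ge (∑ i, a i) (k.choose 2 * (2 * m)) with h | h
    · rw [conv_eq_zero_of_homogeneous _ (fun j => creationCoeff_of_neg m) _
        (isHomogeneous_vdm_pow k (2 * m)) (by exact_mod_cast h), Finsupp.single_zero]
      exact zero_mem _
    · obtain ⟨d, hd⟩ := Nat.exists_eq_add_of_le h
      exact le_iSup (gradedPart m p n) (k, d)
        (Submodule.mem_map_of_mem (Submodule.subset_span ⟨a, ha, hd, rfl⟩))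
  · rw [gradedPart, fockPart, Submodule.map_span_le]
    rintro _ ⟨a, ha, _, rfl⟩
    exact Submodule.subset_span ⟨kd.1, a, ha, rfl⟩

theorem isWeightedHomogeneous_of_mem_fockPart {m n k d : ℕ} {u : Fock}
    (hu : u ∈ fockPart m n k d) : u.IsWeightedHomogeneous modeWeight d := by
  have h : fockPart m n k d ≤ MvPolynomial.weightedHomogeneousSubmodule ℂ modeWeight d := by
    rw [fockPart, Submodule.span_le]
    rintro _ ⟨a, _, hs, rfl⟩
    exact isWeightedHomogeneous_conv m _ (isHomogeneous_vdm_pow k (2 * m)) (by exact_mod_cast hs)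
  exact h hu

/-- The eigenvalues of `h₀` and `L₀` on the graded parts. -/
def bidegree (m : ℕ) (p : ℤ) (kd : ℕ × ℕ) : ℂ × ℂ :=
  (degZ m p + kd.1 * sqrtTwo m, degQ m (p - 2 * kd.1 * m) + kd.2)

theorem bidegree_injective {m : ℕ} (hm : 1 ≤ m) (p : ℤ) : Function.Injective (bidegree m p) := by
  rintro ⟨k, d⟩ ⟨k', d'⟩ h
  simp only [bidegree, Prod.mk.injEq, add_right_inj] at h
  obtain ⟨h1, h2⟩ := h
  have h3 := mul_right_cancel₀ (sqrtTwo_ne_zero hm) h1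
  have h4 : k = k' := by exact_mod_cast h3
  subst h4
  have h5 := add_left_cancel h2
  rw [Prod.mk.injEq]
  exact ⟨rfl, by exact_mod_cast h5⟩

theorem gradedPart_le_jointEigenspace {m : ℕ} (hm : 1 ≤ m) (p : ℤ) (n : ℕ) (kd : ℕ × ℕ) :
    gradedPart m p n kd ≤ jointEigenspace m (bidegree m p kd) := by
  rintro _ ⟨u, hu, rfl⟩
  have hs := sqrtTwo_ne_zero hm
  have hsq := sqrtTwo_sq m
  refine ⟨Module.End.mem_eigenspace_iff.2 ?_, Module.End.mem_eigenspace_iff.2 ?_⟩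
  · rw [Finsupp.lsingle_apply, heis_zero_single]
    congr 1
    rw [bidegree, degZ]
    push_cast
    field_simp
    rw [hsq]
    ring
  · have h1 : (-p + 2 * m * kd.1 : ℤ) = -(p - 2 * kd.1 * m) := by ring
    rw [Finsupp.lsingle_apply, h1, virL0_single hm _ kd.2 _ (isWeightedHomogeneous_of_mem_fockPart hu)]
    rfl

theorem finrank_gradedPart {m : ℕ} (hm : 1 ≤ m) (p : ℤ) (n : ℕ) (kd : ℕ × ℕ) :
    Module.Finite ℂ (gradedPart m p n kd) ∧ (Module.finrank ℂ (gradedPart m p n kd) : ℤ) =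
      (boxPoly kd.1 (n - m * (kd.1 - 1))).coeff kd.2 := by
  have := finite_fockPart hm n kd.1 kd.2
  refine ⟨inferInstanceAs (Module.Finite ℂ (Submodule.map _ _)), ?_⟩
  rw [← finrank_fockPart hm, gradedPart]
  exact_mod_cast (LinearEquiv.finrank_eq (Submodule.equivMapOfInjective
    (Finsupp.lsingle (-p + 2 * m * kd.1) : Fock →ₗ[ℂ] Space)
    (Finsupp.single_injective _) (fockPart m n kd.1 kd.2))).symm

theorem iSupIndep_gradedPart {m : ℕ} (hm : 1 ≤ m) (p : ℤ) (n : ℕ) :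
    iSupIndep (gradedPart m p n) :=
  ((iSupIndep_jointEigenspace hm).comp (bidegree_injective hm p)).mono
    (gradedPart_le_jointEigenspace hm p n)

/-! ### Box polynomials and the numbers `F^{(m)}_n` -/

theorem boxPoly_succ_zero (k : ℕ) : boxPoly (k + 1) 0 = 0 := by rw [boxPoly]

theorem boxPoly_zero_left (N : ℕ) : boxPoly 0 N = 1 := by cases N <;> rw [boxPoly]

theorem boxPoly_eq_zero {m n k : ℕ} (hm : 1 ≤ m) (h : n + 2 ≤ k) :
    boxPoly k (n - m * (k - 1)) = 0 := by
  obtain ⟨j, rfl⟩ : ∃ j, k = j + 1 := ⟨k - 1, by omega⟩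
  have : n - m * (j + 1 - 1) = 0 := by
    rw [Nat.add_sub_cancel]
    have := Nat.mul_le_mul_right j hm
    omega
  rw [this, boxPoly_succ_zero]

/-- This is the Pascal rule at q = 1, for boxes whose height drops by m with each further part. -/
theorem eval_one_boxPoly_rec {m : ℕ} (hm : 1 ≤ m) (n k : ℕ) :
    (boxPoly (k + 1) (n + m - m * k)).eval 1 =
      (boxPoly (k + 1) (n + m - 1 - m * k)).eval 1 + (boxPoly k (n - m * (k - 1))).eval 1 := by
  rcases lt_or_ge (m * k) (n + m) with h | h
  · obtain ⟨N, hN⟩ : ∃ N, n + m - m * k = N + 1 := ⟨n + m - m * k - 1, by omega⟩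
    have h1 : n + m - 1 - m * k = N := by omega
    -- For k = 0 the truncated k - 1 makes the two heights differ, but with no parts the height is
    -- irrelevant.
    have h2 : boxPoly k (n - m * (k - 1)) = boxPoly k (N + 1) := by
      cases k with
      | zero => rw [boxPoly_zero_left, boxPoly_zero_left]
      | succ j =>
        congr 1
        rw [Nat.add_sub_cancel]
        rw [Nat.mul_succ] at hN h
        omega
    rw [hN, h1, h2, boxPoly]
    simp [add_comm]
  · cases k with
    | zero => omega
    | succ j =>
      rw [Nat.mul_succ] at h ⊢
      have h1 : n + m - (m * j + m) = 0 := by omega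
      have h2 : n + m - 1 - (m * j + m) = 0 := by omega
      have h3 : n - m * (j + 1 - 1) = 0 := by rw [Nat.add_sub_cancel]; omega
      rw [h1, h2, h3]
      simp [boxPoly_succ_zero]

theorem eval_one_boxPoly_one (n : ℕ) : (boxPoly 1 n).eval 1 = n := by
  induction n with
  | zero => simp [boxPoly_succ_zero]
  | succ n ih => rw [boxPoly]; simp [ih, boxPoly_zero_left, add_comm]

/-- The cutoff K is left free because the recursion compares sums of lengths K + 1 and K; terms with
k ≥ n + 2 vanish. For n < m only k = 0 and k = 1 contribute, namely 1 and n. -/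
theorem sum_eval_one_boxPoly {m : ℕ} (hm : 1 ≤ m) (n K : ℕ) (hK : n + 2 ≤ K) :
    ∑ k ∈ Finset.range K, (boxPoly k (n - m * (k - 1))).eval 1 = (fibNum m n : ℤ) := by
  induction n using Nat.strong_induction_on generalizing K with
  | _ n ih =>
    rcases lt_or_ge n m with h | h
    · obtain ⟨K, rfl⟩ := Nat.exists_eq_add_of_le' (show 2 ≤ K by omega)
      have h0 : ∀ k ∈ Finset.range K,
          (boxPoly (k + 1 + 1) (n - m * (k + 1 + 1 - 1))).eval 1 = 0 := by
        intro k _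
        have : n - m * (k + 1 + 1 - 1) = 0 := by
          rw [Nat.add_sub_cancel, Nat.mul_succ]
          omega
        rw [this, boxPoly_succ_zero, eval_zero]
      rw [Finset.sum_range_succ', Finset.sum_range_succ', Finset.sum_eq_zero h0, boxPoly_zero_left,
        fibNum_of_lt h]
      simp [eval_one_boxPoly_one]
    · obtain ⟨i, rfl⟩ := Nat.exists_eq_add_of_le' h
      obtain ⟨K, rfl⟩ : ∃ j, K = j + 1 := ⟨K - 1, by omega⟩
      rw [fibNum_add hm, Nat.cast_add, ← ih (i + m - 1) (by omega) (K + 1) (by omega),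
        ← ih i (by omega) K (by omega), Finset.sum_range_succ', Finset.sum_range_succ' _ K]
      simp only [Nat.add_sub_cancel, eval_one_boxPoly_rec hm, Finset.sum_add_distrib,
        boxPoly_zero_left]
      ring

/-- A box with k ≥ 1 parts below N > 0 is counted by the binomial with top N - 1 + k, and N = p -
m(k-1) gives p - (m-1)(k-1). If the height truncates to zero, the top is less than k and both sides
vanish. -/
theorem gauss_eq_boxPoly {m : ℕ} (hm : 1 ≤ m) (p k : ℕ) :
    gauss ((p : ℤ) - ((m : ℤ) - 1) * ((k : ℤ) - 1)) k = boxPoly k (p - m * (k - 1)) := by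
  cases k with
  | zero =>
    have : (0 : ℤ) ≤ (p : ℤ) - ((m : ℤ) - 1) * (((0 : ℕ) : ℤ) - 1) := by push_cast; omega
    rw [gauss, if_pos this, boxPoly_zero_left, gaussNat]
  | succ j =>
    have h0 : (p : ℤ) - ((m : ℤ) - 1) * (((j + 1 : ℕ) : ℤ) - 1) = (p : ℤ) - (m * j : ℕ) + j := by
      push_cast; ring
    rw [h0, Nat.add_sub_cancel]
    rcases lt_or_ge (m * j) p with h | h
    · obtain ⟨N, hN⟩ : ∃ N, p - m * j = N + 1 := ⟨p - m * j - 1, by omega⟩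
      have h1 : (p : ℤ) - (m * j : ℕ) + j = (N + (j + 1) : ℕ) := by omega
      rw [hN, boxPoly_succ, h1, gauss, if_pos (by positivity), Int.toNat_natCast]
    · have h1 : p - m * j = 0 := by omega
      rw [h1, boxPoly_succ_zero, gauss]
      split_ifs
      · exact gaussNat_self_succ _ _ (by omega)
      · rfl

/-! ### Dimension and character -/

/-- A bound for the degrees of all box polynomials that occur in the character. -/
def degreeBound (m n : ℕ) : ℕ :=
  (Finset.range (n + 2)).sup (fun k => (boxPoly k (n - m * (k - 1))).natDegree) + 1

theorem natDegree_lt_degreeBound (m : ℕ) {n k : ℕ} (hk : k ∈ Finset.range (n + 2)) :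
    (boxPoly k (n - m * (k - 1))).natDegree < degreeBound m n :=
  Nat.lt_succ_of_le
    (Finset.le_sup (f := fun k => (boxPoly k (n - m * (k - 1))).natDegree) hk)

/-- The set of indices outside of which the graded parts vanish. -/
def gradedIndices (m n : ℕ) : Finset (ℕ × ℕ) :=
  Finset.range (n + 2) ×ˢ Finset.range (degreeBound m n)

theorem gradedPart_eq_bot {m : ℕ} (hm : 1 ≤ m) (p : ℤ) (n : ℕ) {kd : ℕ × ℕ}
    (h : kd ∉ gradedIndices m n) : gradedPart m p n kd = ⊥ := by
  obtain ⟨h1, h2⟩ := finrank_gradedPart hm p n kd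
  rw [← Submodule.finrank_eq_zero, ← Nat.cast_eq_zero (R := ℤ), h2]
  rcases lt_or_ge kd.1 (n + 2) with hk | hk
  · have hd : degreeBound m n ≤ kd.2 := by
      by_contra hlt
      exact h (Finset.mem_product.2 ⟨Finset.mem_range.2 hk, Finset.mem_range.2 (not_le.1 hlt)⟩)
    exact coeff_eq_zero_of_natDegree_lt
      ((natDegree_lt_degreeBound m (Finset.mem_range.2 hk)).trans_le hd)
  · rw [boxPoly_eq_zero hm hk, coeff_zero]

theorem finitization_eq_sup {m : ℕ} (hm : 1 ≤ m) (p : ℤ) (n : ℕ) :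
    finitization m p n = (gradedIndices m n).sup (gradedPart m p n) := by
  rw [finitization_eq_iSup]
  refine le_antisymm (iSup_le fun kd => ?_) (Finset.sup_le fun kd _ => le_iSup _ kd)
  by_cases h : kd ∈ gradedIndices m n
  · exact Finset.le_sup h
  · rw [gradedPart_eq_bot hm p n h]
    exact bot_le

theorem finite_finitization {m : ℕ} (hm : 1 ≤ m) (p : ℤ) (n : ℕ) :
    Module.Finite ℂ (finitization m p n) := by
  rw [finitization_eq_sup hm]
  exact (finrank_finset_sup (iSupIndep_gradedPart hm p n)
    (fun kd => (finrank_gradedPart hm p n kd).1) _).1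

theorem finrank_finitization {m : ℕ} (hm : 1 ≤ m) (p : ℤ) (n : ℕ) :
    Module.finrank ℂ (finitization m p n) = fibNum m n := by
  rw [finitization_eq_sup hm, (finrank_finset_sup (iSupIndep_gradedPart hm p n)
    (fun kd => (finrank_gradedPart hm p n kd).1) _).2]
  zify
  rw [← sum_eval_one_boxPoly hm n (n + 2) le_rfl, gradedIndices, Finset.sum_product]
  refine Finset.sum_congr rfl fun k hk => ?_
  rw [eval_eq_sum_range' (natDegree_lt_degreeBound m hk)]
  refine Finset.sum_congr rfl fun d _ => ?_
  rw [(finrank_gradedPart hm p n (k, d)).2, one_pow, mul_one]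

theorem bidegreePart_bidegree {m : ℕ} (hm : 1 ≤ m) (p : ℤ) (n : ℕ) (kd : ℕ × ℕ) :
    bidegreePart m (finitization m p n) (bidegree m p kd) = gradedPart m p n kd := by
  rw [bidegreePart, inf_assoc, finitization_eq_iSup]
  exact iSup_inf_of_iSupIndep (iSupIndep_jointEigenspace hm) (bidegree_injective hm p)
    (gradedPart_le_jointEigenspace hm p n) kd

theorem bidegreePart_eq_bot {m : ℕ} (hm : 1 ≤ m) (p : ℤ) (n : ℕ) {d : ℂ × ℂ}
    (hd : d ∉ Set.range (bidegree m p)) : bidegreePart m (finitization m p n) d = ⊥ := by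
  rw [bidegreePart, inf_assoc, finitization_eq_iSup]
  exact iSup_inf_eq_bot_of_iSupIndep (iSupIndep_jointEigenspace hm)
    (gradedPart_le_jointEigenspace hm p n) hd

theorem iSup_bidegreePart {m : ℕ} (hm : 1 ≤ m) (p : ℤ) (n : ℕ) :
    ⨆ d, bidegreePart m (finitization m p n) d = finitization m p n := by
  refine le_antisymm (iSup_le fun d => inf_le_left.trans inf_le_left) ?_
  conv_lhs => rw [finitization_eq_iSup]
  refine iSup_le fun kd => ?_
  rw [← bidegreePart_bidegree hm]
  exact le_iSup (bidegreePart m (finitization m p n)) _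

theorem zPow_add (a b : ℂ) : zPow (a + b) = zPow a * zPow b := by
  simp [zPow, AddMonoidAlgebra.single_mul_single]

theorem qPow_add (a b : ℂ) : qPow (a + b) = qPow a * qPow b := by
  simp [qPow, AddMonoidAlgebra.single_mul_single]

theorem qPow_one_pow (d : ℕ) : qPow 1 ^ d = qPow d := by
  simp [qPow, AddMonoidAlgebra.single_pow]

theorem character_finitization {m : ℕ} (hm : 1 ≤ m) (p : ℤ) (n : ℕ) :
    character m (finitization m p n) =
      zPow (degZ m p) * ∑ᶠ k : ℕ, zPow (k * sqrtTwo m) * qPow (degQ m (p - 2 * k * m)) *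
        ofQ (boxPoly k (n - m * (k - 1))) := by
  classical
  have h1 : (Function.support fun k : ℕ => zPow (k * sqrtTwo m) *
      qPow (degQ m (p - 2 * k * m)) * ofQ (boxPoly k (n - m * (k - 1)))) ⊆
      Finset.range (n + 2) := by
    intro k hk
    by_contra hlt
    apply hk
    rw [Finset.mem_coe, Finset.mem_range, not_lt] at hlt
    simp only [boxPoly_eq_zero hm hlt, ofQ, map_zero, mul_zero]
  have h2 : (Function.support fun d : ℂ × ℂ =>
      (Module.finrank ℂ (bidegreePart m (finitization m p n) d) : ℤ) •
        (zPow d.1 * qPow d.2)) ⊆ (gradedIndices m n).image (bidegree m p) := by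
    intro d hd
    by_contra hnot
    apply hd
    have h0 : bidegreePart m (finitization m p n) d = ⊥ := by
      by_cases hr : d ∈ Set.range (bidegree m p)
      · obtain ⟨kd, rfl⟩ := hr
        rw [bidegreePart_bidegree hm]
        refine gradedPart_eq_bot hm p n fun h => hnot ?_
        exact Finset.mem_coe.2 (Finset.mem_image_of_mem _ h)
      · exact bidegreePart_eq_bot hm p n hr
    have h3 : Module.finrank ℂ (bidegreePart m (finitization m p n) d) = 0 :=
      h0 ▸ finrank_bot ℂ Space
    change (Module.finrank ℂ (bidegreePart m (finitization m p n) d) : ℤ) • _ = _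
    rw [h3, Nat.cast_zero, zero_smul]
  rw [character, finsum_eq_sum_of_support_subset _ h2, finsum_eq_sum_of_support_subset _ h1,
    Finset.sum_image (bidegree_injective hm p).injOn, gradedIndices, Finset.sum_product,
    Finset.mul_sum]
  refine Finset.sum_congr rfl fun k hk => ?_
  rw [ofQ, aeval_eq_sum_range' (natDegree_lt_degreeBound m hk), Finset.mul_sum, Finset.mul_sum]
  refine Finset.sum_congr rfl fun d _ => ?_
  rw [bidegreePart_bidegree hm, (finrank_gradedPart hm p n (k, d)).2, bidegree, zPow_add, qPow_add,
    qPow_one_pow, mul_smul_comm, mul_smul_comm]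
  congr 1
  ring

end BosonicPrincipal

end

theorem mainTheorem2 (m : ℕ) (hm : 1 ≤ m) :
    (∀ p : ℕ,
      Module.Finite ℂ (principal m p) ∧
      (⨆ d : ℂ × ℂ, bidegreePart m (principal m p) d) = principal m p ∧
      character m (principal m p) =
        zPow (degZ m p) *
          ∑ᶠ k : ℕ, zPow (k * sqrtTwo m) * qPow (degQ m ((p : ℤ) - 2 * k * m)) *
            ofQ (gauss ((p : ℤ) - ((m : ℤ) - 1) * ((k : ℤ) - 1)) k)) ∧
    (∀ (p : ℤ) (n : ℕ),
      Module.Finite ℂ (finitization m p n) ∧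
      Module.finrank ℂ (finitization m p n) = fibNum m n) := by
  refine ⟨fun p => ⟨finite_finitization hm p p, iSup_bidegreePart hm p p, ?_⟩,
    fun p n => ⟨finite_finitization hm p n, finrank_finitization hm p n⟩⟩
  simp only [gauss_eq_boxPoly hm]
  exact character_finitization hm p p
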